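/- Let $R$ be a subring of $\mathbb Q$ and let $G\neq 0$ be an $R$-module. Definitions. $G$ is a *splitter* if $\mathrm{Ext}_R(G,G)=0$, i.e. every short exact sequence $0\to G\to X\to G\to 0$ of $R$-modules splits. An $R$-module is *$\aleph_1$-free* if all its countably generated submodules are free. An *$\aleph_1$-filtration* of $G$ is an ascending continuous chain $(G_\alpha)_{\alpha<\omega_1}$ of countable, free, pure submodules with $G_0=0$ and $\bigcup_{\alpha<\omega_1}G_\alpha=G$. $G$ is *of type II* if it has an $\aleph_1$-filtration such that $G/G_\alpha$ is $\aleph_1$-free for every non-limit ordinal $\alpha<\omega_1$ ($\alpha=0$ or $\alpha$ a successor). The *nucleus* of $G$ is the subring of $\mathbb Q$ generated by all $1/p$, $p$ a prime with $pG=G$. The invariant $\Gamma(G)$ is the class of $\{\alpha<\omega_1 : G/G_\alpha \text{ is not } \aleph_1\text{-free}\}$, for an $\aleph_1$-filtration $(G_\alpha)$ of $G$, in the power set of $\omega_1$ modulo the ideal of thin (nonstationary) sets; $\Gamma(G)=0$ means that this set is thin. $G$ is *strongly $\aleph_1$-free* if it is $\aleph_1$-free and every countable subset of $G$ is contained in a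 countably generated submodule $N$ such that $G/N$ is $\aleph_1$-free. **Theorem.** If $G$ is of type II, then the nucleus of $G$ is $R$, and $G$ is a splitter if and only if $G$ is free over its nucleus $R$. Moreover $\Gamma(G)$ does not depend on the choice of the $\aleph_1$-filtration, and $G$ is a splitter if and only if $\Gamma(G)=0$. In particular, if $G$ is strongly $\aleph_1$-free, $|G|\le\aleph_1$, and $G$ is not a free $R$-module, then $G$ is not a splitter. -/

import Mathlib

open scoped Ordinal Cardinal

namespace AlmostFreeSplitters

universe u

/-- The nucleus of a (nonzero, torsion-free) abelian group `G`: the subring of `ℚ` generated by all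
`1 / p`, `p` a prime with `p G = G`. -/
def nucleus (G : Type u) [AddCommGroup G] : Subring ℚ :=
  Subring.closure {q : ℚ | ∃ p : ℕ, p.Prime ∧ (∀ g : G, ∃ h : G, p • h = g) ∧ q = 1 / (p : ℚ)}

section Modules

variable (R : Type) [CommRing R] (G : Type u) [AddCommGroup G] [Module R G]

/-- `G` is a splitter: every short exact sequence `0 → G → X → G → 0` of `R`-modules splits, that
is, `Ext_R (G, G) = 0`. The module `X` has the cardinality of `G × G`, so that nothing is lost by
taking it in the universe of `G`. -/
def IsSplitter : Prop :=
  ∀ (X : Type u) [AddCommGroup X] [Module R X] (β : G →ₗ[R] X) (α : X →ₗ[R] G),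
    Function.Injective β → Function.Exact β α → Function.Surjective α →
      ∃ γ : G →ₗ[R] X, α ∘ₗ γ = LinearMap.id

/-- `G` is `ℵ₁`-free: every countably generated submodule is free. -/
def IsAlephOneFree : Prop :=
  ∀ s : Set G, s.Countable → Module.Free R (Submodule.span R s)

/-- `G` is strongly `ℵ₁`-free: it is `ℵ₁`-free, and every countable subset lies in a countably
generated submodule `N` such that `G / N` is `ℵ₁`-free. -/
def IsStronglyAlephOneFree : Prop :=
  IsAlephOneFree R G ∧
    ∀ s : Set G, s.Countable → ∃ t : Set G, t.Countable ∧ s ⊆ Submodule.span R t ∧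
      IsAlephOneFree R (G ⧸ Submodule.span R t)

variable {G} in
/-- The submodule `H` is pure in `G`: `r G ∩ H = r H` for all `r ∈ R`. -/
def IsPureSubmodule (H : Submodule R G) : Prop :=
  ∀ (r : R) (x : G), r • x ∈ H → ∃ y ∈ H, r • y = r • x

end Modules

/-- The well-ordered set `ω₁` of all countable ordinals. -/
abbrev OmegaOne : Type 1 := Set.Iio (ω₁ : Ordinal.{0})

theorem cof_omegaOne_ne : Order.cof OmegaOne ≠ ℵ₀ := by
  rw [Ordinal.cof_Iio, ← Ordinal.lift_cof, Cardinal.cof_omega_one]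
  simpa using (Cardinal.aleph0_lt_aleph_one).ne'

/-- Two subsets of `ω₁` are identified when their symmetric difference is thin (nonstationary). -/
instance moduloThin : Setoid (Set OmegaOne) where
  r S T := ¬ IsStationary (symmDiff S T)
  iseqv :=
    { refl := fun S => by simp
      symm := fun {S T} h => by rwa [symmDiff_comm]
      trans := fun {S T U} h₁ h₂ h =>
        ((isStationary_union_iff cof_omegaOne_ne).1 (h.mono (symmDiff_triangle S T U))).elim h₁ h₂ }

/-- The power set of `ω₁` modulo the ideal of thin sets. -/
abbrev GammaValue : Type 1 := Quotient moduloThin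

/-- The class of the empty set, which consists of the thin sets. -/
instance : Zero GammaValue := ⟨⟦∅⟧⟩

theorem gammaValue_eq_zero_iff (S : Set OmegaOne) :
    (⟦S⟧ : GammaValue) = 0 ↔ ¬ IsStationary S := by
  change (⟦S⟧ : GammaValue) = ⟦∅⟧ ↔ _
  rw [Quotient.eq]
  change ¬ IsStationary (symmDiff S ∅) ↔ _
  rw [← Set.bot_eq_empty, symmDiff_bot]

section Filtrations

variable (R : Type) [CommRing R] (G : Type u) [AddCommGroup G] [Module R G]

variable {G} in
/-- An `ℵ₁`-filtration of `G`: an ascending continuous chain, indexed by `ω₁`, of countable, free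
and pure submodules, which starts with `0` and has union `G`. -/
structure IsAlephOneFiltration (F : OmegaOne → Submodule R G) : Prop where
  zero : ∀ α, α.1 = 0 → F α = ⊥
  mono : Monotone F
  continuous : ∀ α, Order.IsSuccLimit α → F α = ⨆ β ∈ Set.Iio α, F β
  countable : ∀ α, Countable (F α)
  free : ∀ α, Module.Free R (F α)
  pure : ∀ α, IsPureSubmodule R (F α)
  exhaustive : ∀ x : G, ∃ α, x ∈ F α

/-- `G` is of type II: it has an `ℵ₁`-filtration `(G_α)` such that `G / G_α` is `ℵ₁`-free for all
non-limit ordinals `α < ω₁`, that is, for `α = 0` and all successors `α`. -/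
def IsTypeII : Prop :=
  ∃ F : OmegaOne → Submodule R G, IsAlephOneFiltration R F ∧
    ∀ α, ¬ Order.IsSuccLimit α → IsAlephOneFree R (G ⧸ F α)

variable {G} in
/-- The class modulo thin sets of the set of all `α < ω₁` such that `G / G_α` is not `ℵ₁`-free. -/
def gammaOf (F : OmegaOne → Submodule R G) : GammaValue :=
  ⟦{α | ¬ IsAlephOneFree R (G ⧸ F α)}⟧

open Classical in
/-- The `Γ`-invariant of `G`, computed from some `ℵ₁`-filtration. -/
noncomputable def gammaInvariant : GammaValue :=
  if h : ∃ F : OmegaOne → Submodule R G, IsAlephOneFiltration R F then gammaOf R h.choose else 0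

end Filtrations

end AlmostFreeSplitters

/-! The main point is that a splitter `G` with a type II filtration `F` has `G / F α` `ℵ₁`-free for
all `α` outside a thin set. Let `S` be the set of the other `α` and suppose that it is stationary.
For `α ∈ S` with successor `β`, the countable torsion-free module `N = F β / F α` is not free, since
otherwise `G / F α` would be an extension of the `ℵ₁`-free `G / F β` by a free module. The heart of
the proof is that then `Ext (N, G / F β) ≠ 0` (`not_forall_exists_extension_of_not_free`).

To see this, use Pontryagin's criterion to choose a nonzero `S₀ ≤ N` without nonzero free quotients.
Vanishing of `Ext (N, G / F β)` passes to `S₀`. A later term of the filtration gives a nonzero free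
`K ≤ G / F β` with `ℵ₁`-free quotient. There are no nonzero maps from `S₀` into that quotient, so
`Ext (S₀, K) = 0` and hence `Ext (S₀, R) = 0`. Together with `Hom (S₀, R) = 0` this makes `S₀`
divisible by an irreducible `ϖ`, and the vanishing of `Ext` on the resulting copy of `R[1 / ϖ]`
forces `R` to be uncountable.

In the canonical presentation of `G` by the free module on its elements, the relations split along
the filtration into complements `D β`. Nonvanishing of `Ext` provides a map `D β → G` that no `φ`
carrying `F α` into `F β` extends (`exists_linearMap_not_extendable`). This obstruction does not
depend on the rest of `φ`, so no prediction principle is needed: the maps combine to one map on all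
relations, a splitter extends it to some `φ`, and `φ` respects `F α` for a club of `α`. A point of
this club in `S` gives a contradiction.

Conversely, if `S` is thin, then `F` restricted to a club has free successive quotients, so `G` is
free, and free modules split. Two filtrations agree on a club, so `Γ` is well defined. A strongly
`ℵ₁`-free module of size at most `ℵ₁` is of type II by a transfinite construction. -/

namespace AlmostFreeSplitters

universe u

/-! ### Direct decompositions along well-ordered chains -/

section Chains

variable {R M ι : Type*} [CommRing R] [AddCommGroup M] [Module R M]
  [LinearOrder ι] [WellFoundedLT ι]

/-- A well-ordered family `B` of submodules with union `M`, together with complements `C i` of the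
union of the earlier terms in `B i`, decomposes `M` as a direct sum. -/
theorem isInternal_of_chain [DecidableEq ι] {B C : ι → Submodule R M}
    (htop : ⨆ i, B i = ⊤) (hCB : ∀ i, C i ≤ B i)
    (hdisj : ∀ i, Disjoint (C i) (⨆ j ∈ Set.Iio i, B j))
    (hsup : ∀ i, B i ≤ C i ⊔ ⨆ j ∈ Set.Iio i, B j) : DirectSum.IsInternal C := by
  refine DirectSum.isInternal_submodule_of_iSupIndep_of_iSup_eq_top ?_ ?_
  · refine iSupIndep_of_dfinsupp_lsum_injective _ ?_
    rw [injective_iff_map_eq_zero]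
    intro v hv
    by_contra hne
    classical
    have hs : v.support.Nonempty := by
      rwa [Finset.nonempty_iff_ne_empty, Ne, DFinsupp.support_eq_empty]
    -- In a vanishing sum the component of largest index is minus a sum of earlier ones, so it lies
    -- in `C i` and in the union below `i`.
    set i := v.support.max' hs with hi
    have hmem : i ∈ v.support := v.support.max'_mem hs
    have hsum : ∑ j ∈ v.support, (v j : M) = 0 := by
      have := hv
      simpa [DFinsupp.sumAddHom_apply, DFinsupp.sum] using this
    rw [← Finset.add_sum_erase _ _ hmem] at hsum
    have h2 : (v i : M) ∈ ⨆ j ∈ Set.Iio i, B j := by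
      rw [eq_neg_of_add_eq_zero_left hsum]
      refine neg_mem (sum_mem fun j hj => ?_)
      have hj' := Finset.mem_erase.1 hj
      have hlt : j < i := lt_of_le_of_ne (v.support.le_max' j hj'.2) hj'.1
      exact (le_iSup₂_of_le (f := fun j (_ : j ∈ Set.Iio i) => B j) j hlt (hCB j)) (v j).2
    have := (Submodule.disjoint_def.1 (hdisj i)) _ (v i).2 h2
    exact (DFinsupp.mem_support_iff.1 hmem) (by simpa using this)
  · have key : ∀ i, B i ≤ ⨆ j, C j := fun i => by
      induction i using WellFoundedLT.induction with
      | ind i ih =>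
        exact (hsup i).trans (sup_le (le_iSup C i) (iSup₂_le fun j hj => ih j hj))
    exact top_le_iff.1 (htop ▸ iSup_le key)

/-- A direct sum of free submodules along a chain is free. -/
theorem free_of_chain {B C : ι → Submodule R M}
    (htop : ⨆ i, B i = ⊤) (hCB : ∀ i, C i ≤ B i)
    (hdisj : ∀ i, Disjoint (C i) (⨆ j ∈ Set.Iio i, B j))
    (hsup : ∀ i, B i ≤ C i ⊔ ⨆ j ∈ Set.Iio i, B j) (hfree : ∀ i, Module.Free R (C i)) :
    Module.Free R M := by
  classical
  have h := isInternal_of_chain htop hCB hdisj hsup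
  exact Module.Free.of_basis (h.collectedBasis fun i => Module.Free.chooseBasis R (C i))

/-- Linear maps can be prescribed on the complements along a chain. -/
theorem exists_linearMap_of_chain {L : Type*} [AddCommGroup L] [Module R L]
    {B C : ι → Submodule R M}
    (htop : ⨆ i, B i = ⊤) (hCB : ∀ i, C i ≤ B i)
    (hdisj : ∀ i, Disjoint (C i) (⨆ j ∈ Set.Iio i, B j))
    (hsup : ∀ i, B i ≤ C i ⊔ ⨆ j ∈ Set.Iio i, B j) (c : ∀ i, C i →ₗ[R] L) :
    ∃ ψ : M →ₗ[R] L, ∀ i (x : C i), ψ x = c i x := by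
  classical
  have h := isInternal_of_chain htop hCB hdisj hsup
  let e : (DirectSum ι fun i => C i) ≃ₗ[R] M :=
    LinearEquiv.ofBijective (DirectSum.coeLinearMap C) h
  refine ⟨(DirectSum.toModule R ι L c) ∘ₗ e.symm.toLinearMap, fun i x => ?_⟩
  have : e.symm (x : M) = DirectSum.lof R ι (fun i => C i) i x := by
    rw [LinearEquiv.symm_apply_eq]
    exact (DirectSum.coeLinearMap_lof C i x).symm
  simp [this]

end Chains

section Complements

variable {R M W : Type*} [CommRing R] [AddCommGroup M] [Module R M] [AddCommGroup W] [Module R W]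

/-- If `A` is the kernel of a linear map on `B` with projective range, then `A` has a complement
in `B`. -/
theorem exists_complement_of_projective_range {A B : Submodule R M} (f : B →ₗ[R] W)
    (hf : ∀ x : B, f x = 0 ↔ (x : M) ∈ A) [Module.Projective R (LinearMap.range f)] :
    ∃ C ≤ B, Disjoint C A ∧ B ≤ C ⊔ A ∧ Nonempty (LinearMap.range f ≃ₗ[R] C) := by
  obtain ⟨s, hs⟩ := Module.projective_lifting_property f.rangeRestrict LinearMap.id
    f.surjective_rangeRestrict
  have hs' : ∀ y, f (s y) = y := fun y => by
    have := congrArg Subtype.val (LinearMap.congr_fun hs y)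
    simpa using this
  have hinj : Function.Injective (B.subtype ∘ₗ s) := by
    intro y z hyz
    have : s y = s z := Subtype.ext hyz
    exact Subtype.ext (by rw [← hs' y, ← hs' z, this])
  refine ⟨LinearMap.range (B.subtype ∘ₗ s), ?_, ?_, ?_, ⟨LinearEquiv.ofInjective _ hinj⟩⟩
  · rintro _ ⟨y, rfl⟩
    exact (s y).2
  · rw [Submodule.disjoint_def]
    rintro _ ⟨y, rfl⟩ hy
    have h0 : f (s y) = 0 := (hf _).2 hy
    rw [hs'] at h0
    have : y = 0 := Subtype.ext h0
    simp [this]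
  · intro x hx
    set y := f.rangeRestrict ⟨x, hx⟩ with hy
    have : x = (s y : M) + (x - (s y : M)) := by abel
    rw [this]
    refine Submodule.add_mem_sup ⟨y, rfl⟩ ?_
    refine (hf (⟨x, hx⟩ - s y)).1 ?_
    rw [map_sub, hs', hy]
    simp

end Complements

/-! ### Submodules of free modules over a principal ideal domain -/

section PID

variable {R M : Type*} [CommRing R] [IsDomain R] [IsPrincipalIdealRing R]
  [AddCommGroup M] [Module R M]

/-- Submodules of free modules over a principal ideal domain are free. -/
theorem free_submodule [Module.Free R M] (N : Submodule R M) : Module.Free R N := by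
  classical
  obtain ⟨⟨ι, b⟩⟩ := Module.Free.exists_basis (R := R) (M := M)
  obtain ⟨_, _⟩ := exists_wellFoundedLT ι
  -- The filtration by the largest index in the support. The `i`-th coordinate embeds each
  -- successive quotient into `R`, and its range is an ideal, hence free.
  let B : ι → Submodule R N := fun i =>
    { carrier := {x | ∀ j, i < j → b.repr x j = 0}
      add_mem' := fun {x y} hx hy j hj => by simp [hx j hj, hy j hj]
      zero_mem' := fun j _ => by simp
      smul_mem' := fun r x hx j hj => by simp [hx j hj] }
  have hmem : ∀ (x : N) (i : ι), (∀ j, i ≤ j → b.repr x j = 0) → x ∈ ⨆ j ∈ Set.Iio i, B j := by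
    intro x i hx
    by_cases h0 : (b.repr (x : M)).support.Nonempty
    · set k := (b.repr (x : M)).support.max' h0 with hk
      have hki : k < i := by
        by_contra hcon
        exact (Finsupp.mem_support_iff.1 (Finset.max'_mem _ h0)) (hx k (not_lt.1 hcon))
      refine Submodule.mem_iSup_of_mem k (Submodule.mem_iSup_of_mem hki fun j hj => ?_)
      by_contra hcon
      exact absurd (Finset.le_max' _ j (Finsupp.mem_support_iff.2 hcon)) (not_le.2 hj)
    · rw [Finset.not_nonempty_iff_eq_empty, Finsupp.support_eq_empty] at h0
      have : x = 0 := by simpa using h0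
      rw [this]; exact zero_mem _
  have hle : ∀ i (x : N), x ∈ ⨆ j ∈ Set.Iio i, B j → ∀ j, i ≤ j → b.repr x j = 0 := by
    intro i x hx
    let D : Submodule R N :=
      { carrier := {x | ∀ j, i ≤ j → b.repr x j = 0}
        add_mem' := fun {x y} hx hy j hj => by simp [hx j hj, hy j hj]
        zero_mem' := fun j _ => by simp
        smul_mem' := fun r x hx j hj => by simp [hx j hj] }
    have : ⨆ j ∈ Set.Iio i, B j ≤ D := iSup₂_le fun j hj y hy k hk => hy k (lt_of_lt_of_le hj hk)
    exact this hx
  have hC : ∀ i, ∃ C ≤ B i, Disjoint C (⨆ j ∈ Set.Iio i, B j) ∧ B i ≤ C ⊔ (⨆ j ∈ Set.Iio i, B j) ∧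
      Module.Free R C := by
    intro i
    let f : B i →ₗ[R] R := b.coord i ∘ₗ N.subtype ∘ₗ (B i).subtype
    have : Module.Free R (LinearMap.range f) := inferInstance
    have hker : ∀ x : B i, f x = 0 ↔ (x : N) ∈ ⨆ j ∈ Set.Iio i, B j := fun x => by
      refine ⟨fun hx => hmem _ _ fun j hj => ?_, fun hx => hle i _ hx i le_rfl⟩
      rcases hj.eq_or_lt with rfl | hj
      · exact hx
      · exact x.2 j hj
    obtain ⟨C, h1, h2, h3, ⟨e⟩⟩ := exists_complement_of_projective_range f hker
    exact ⟨C, h1, h2, h3, Module.Free.of_equiv e⟩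
  choose C h1 h2 h3 h4 using hC
  refine free_of_chain (B := B) (C := C) ?_ h1 h2 h3 h4
  rw [eq_top_iff]
  intro x _
  by_cases h0 : (b.repr (x : M)).support.Nonempty
  · refine Submodule.mem_iSup_of_mem ((b.repr (x : M)).support.max' h0) fun j hj => ?_
    by_contra hcon
    exact absurd (Finset.le_max' _ j (Finsupp.mem_support_iff.2 hcon)) (not_le.2 hj)
  · rw [Finset.not_nonempty_iff_eq_empty, Finsupp.support_eq_empty] at h0
    have : x = 0 := by simpa using h0
    rw [this]; exact zero_mem _

/-- A module that embeds into a free module over a principal ideal domain is free. -/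
theorem free_of_injective {L : Type*} [AddCommGroup L] [Module R L] [Module.Free R M]
    (f : L →ₗ[R] M) (hf : Function.Injective f) : Module.Free R L :=
  have := free_submodule (LinearMap.range f)
  Module.Free.of_equiv (LinearEquiv.ofInjective f hf).symm

end PID

section FreeExtension

variable {R N : Type*} [CommRing R] [AddCommGroup N] [Module R N]

/-- An extension of a free module by a free module is free. -/
theorem free_of_free_quotient (D : Submodule R N) [Module.Free R D] [Module.Free R (N ⧸ D)] :
    Module.Free R N := by
  obtain ⟨s, hs⟩ := Module.projective_lifting_property D.mkQ LinearMap.id D.mkQ_surjective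
  have hs' : ∀ y, D.mkQ (s y) = y := fun y => LinearMap.congr_fun hs y
  let f : (D × (N ⧸ D)) →ₗ[R] N := D.subtype.coprod s
  refine Module.Free.of_equiv (LinearEquiv.ofBijective f ⟨?_, fun x => ?_⟩)
  · rw [injective_iff_map_eq_zero]
    rintro ⟨d, q⟩ h
    have h1 : (d : N) + s q = 0 := by simpa [f] using h
    have h2 := congrArg D.mkQ h1
    rw [map_add, hs', map_zero, (Submodule.Quotient.mk_eq_zero D (x := (d : N))).2 d.2 |> fun h =>
      (show D.mkQ (d : N) = 0 from h), zero_add] at h2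
    subst h2
    simpa using h1
  · refine ⟨(⟨x - s (D.mkQ x), ?_⟩, D.mkQ x), by simp [f]⟩
    rw [← Submodule.Quotient.mk_eq_zero]
    change D.mkQ _ = 0
    rw [map_sub, hs', sub_self]

theorem isTorsionFree_quotient_iff [IsDomain R] (A : Submodule R N) :
    Module.IsTorsionFree R (N ⧸ A) ↔ ∀ (r : R) (x : N), r ≠ 0 → r • x ∈ A → x ∈ A := by
  rw [Module.isTorsionFree_iff_smul_eq_zero]
  refine ⟨fun h r x hr hx => ?_, fun h r y hy => ?_⟩
  · have := h r (Submodule.Quotient.mk x) (by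
      rw [← Submodule.Quotient.mk_smul]; exact (Submodule.Quotient.mk_eq_zero A).2 hx)
    exact (Submodule.Quotient.mk_eq_zero A).1 (this.resolve_left hr)
  · obtain ⟨x, rfl⟩ := A.mkQ_surjective y
    by_cases hr : r = 0
    · exact .inl hr
    · refine .inr ((Submodule.Quotient.mk_eq_zero A).2 (h r x hr ?_))
      rw [← map_smul] at hy
      exact (Submodule.Quotient.mk_eq_zero A).1 hy

end FreeExtension

/-! ### Pontryagin's criterion for countable modules -/

section Pontryagin

variable {R N : Type*} [CommRing R] [AddCommGroup N] [Module R N]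

/-- The set of elements with a nonzero multiple in `S`. -/
def saturation (S : Submodule R N) : Submodule R N :=
  (Submodule.torsion R (N ⧸ S)).comap S.mkQ

theorem le_saturation (S : Submodule R N) : S ≤ saturation S := fun x hx => by
  have : S.mkQ x = 0 := (Submodule.Quotient.mk_eq_zero S).2 hx
  simp [saturation, this]

variable [IsDomain R]

theorem mem_saturation {S : Submodule R N} {x : N} :
    x ∈ saturation S ↔ ∃ r : R, r ≠ 0 ∧ r • x ∈ S := by
  simp only [saturation, Submodule.mem_comap, Submodule.mem_torsion_iff]
  constructor
  · rintro ⟨a, ha⟩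
    refine ⟨a, nonZeroDivisors.ne_zero a.2, ?_⟩
    rw [← Submodule.Quotient.mk_eq_zero]
    exact ha
  · rintro ⟨r, hr, h⟩
    refine ⟨⟨r, mem_nonZeroDivisors_of_ne_zero hr⟩, ?_⟩
    exact (Submodule.Quotient.mk_eq_zero S (x := r • x)).2 h

theorem saturation_mono {S T : Submodule R N} (h : S ≤ T) : saturation S ≤ saturation T := by
  intro x hx
  obtain ⟨r, hr, hx⟩ := mem_saturation.1 hx
  exact mem_saturation.2 ⟨r, hr, h hx⟩

theorem mem_saturation_of_smul_mem {S : Submodule R N} {r : R} {x : N} (hr : r ≠ 0)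
    (h : r • x ∈ saturation S) : x ∈ saturation S := by
  obtain ⟨a, ha, h⟩ := mem_saturation.1 h
  exact mem_saturation.2 ⟨a * r, mul_ne_zero ha hr, by rwa [mul_smul]⟩

/-- The image of the saturation in `N ⧸ S` is torsion and contributes no rank. -/
theorem rank_saturation_le (S : Submodule R N) :
    Module.rank R (saturation S) ≤ Module.rank R S := by
  let f : saturation S →ₗ[R] N ⧸ S := S.mkQ ∘ₗ (saturation S).subtype
  rw [← LinearMap.rank_range_add_rank_ker f]
  have h0 : Module.rank R (LinearMap.range f) = 0 := by
    rw [rank_eq_zero_iff]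
    rintro ⟨_, x, rfl⟩
    obtain ⟨r, hr, hx⟩ := mem_saturation.1 x.2
    refine ⟨r, hr, Subtype.ext ?_⟩
    change r • f x = 0
    rw [← map_smul]
    exact (Submodule.Quotient.mk_eq_zero S).2 hx
  rw [h0, zero_add]
  have hk : ∀ x : LinearMap.ker f, (x : saturation S).1 ∈ S := fun x =>
    (Submodule.Quotient.mk_eq_zero S).1 x.2
  refine LinearMap.rank_le_of_injective (LinearMap.codRestrict S
    ((saturation S).subtype ∘ₗ (LinearMap.ker f).subtype) hk) fun x y hxy => ?_
  exact Subtype.ext (Subtype.ext (congrArg (fun z : S => (z : N)) hxy))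

variable [IsPrincipalIdealRing R]

/-- **Pontryagin's criterion**: a countable torsion-free module over a principal ideal domain is
free if all its submodules of finite rank are free. -/
theorem free_of_countable_of_forall_finite_rank [Countable N] [Module.IsTorsionFree R N]
    (h : ∀ S : Submodule R N, Module.rank R S < ℵ₀ → Module.Free R S) : Module.Free R N := by
  obtain ⟨x, hx⟩ := exists_surjective_nat N
  -- Saturating the spans of initial segments of an enumeration keeps the rank finite and makes the
  -- successive quotients torsion-free. They are also finitely generated, hence free.
  let B : ℕ → Submodule R N := fun n => saturation (Submodule.span R (x '' Set.Iic n))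
  have hmono : Monotone B := fun m n hmn =>
    saturation_mono (Submodule.span_mono (Set.image_mono (Set.Iic_subset_Iic.2 hmn)))
  have hrank : ∀ n, Module.rank R (B n) < ℵ₀ := fun n => by
    refine (rank_saturation_le _).trans_lt ?_
    have : Module.Finite R (Submodule.span R (x '' Set.Iic n)) :=
      Module.Finite.span_of_finite R ((Set.finite_Iic n).image x)
    exact Module.rank_lt_aleph0 R _
  have hpure : ∀ n, Module.IsTorsionFree R (N ⧸ ⨆ j ∈ Set.Iio n, B j) := fun n => by
    rw [isTorsionFree_quotient_iff]
    intro r y hr hy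
    cases n with
    | zero => 
      simp only [Set.mem_Iio, not_lt_zero, iSup_false, iSup_bot, Submodule.mem_bot] at hy ⊢
      exact (smul_eq_zero.1 hy).resolve_left hr
    | succ n =>
      have : ⨆ j ∈ Set.Iio (n + 1), B j = B n :=
        le_antisymm (iSup₂_le fun j hj => hmono (Nat.lt_succ_iff.1 hj))
          (le_iSup₂_of_le (f := fun j (_ : j ∈ Set.Iio (n + 1)) => B j) n n.lt_succ_self le_rfl)
      rw [this] at hy ⊢
      exact mem_saturation_of_smul_mem hr hy
  have hC : ∀ n, ∃ C ≤ B n, Disjoint C (⨆ j ∈ Set.Iio n, B j) ∧ B n ≤ C ⊔ (⨆ j ∈ Set.Iio n, B j) ∧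
      Module.Free R C := by
    intro n
    have := hpure n
    have := h (B n) (hrank n)
    have : Module.Finite R (B n) := Module.rank_lt_aleph0_iff.1 (hrank n)
    let f : B n →ₗ[R] N ⧸ ⨆ j ∈ Set.Iio n, B j := (Submodule.mkQ _) ∘ₗ (B n).subtype
    have hfree : Module.Free R (LinearMap.range f) := inferInstance
    obtain ⟨C, h1, h2, h3, ⟨e⟩⟩ := exists_complement_of_projective_range f
      (A := ⨆ j ∈ Set.Iio n, B j) fun y => Submodule.Quotient.mk_eq_zero _
    exact ⟨C, h1, h2, h3, Module.Free.of_equiv e⟩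
  choose C h1 h2 h3 h4 using hC
  refine free_of_chain (B := B) (C := C) ?_ h1 h2 h3 h4
  rw [eq_top_iff]
  intro y _
  obtain ⟨n, rfl⟩ := hx y
  exact Submodule.mem_iSup_of_mem n (le_saturation _ (Submodule.subset_span ⟨n, Set.self_mem_Iic, rfl⟩))

/-- A countable torsion-free module that is not free has a nonzero submodule without nonzero free
quotients. -/
theorem exists_submodule_without_free_quotient [Countable N] [Module.IsTorsionFree R N]
    (h : ¬ Module.Free R N) :
    ∃ S : Submodule R N, S ≠ ⊥ ∧ ∀ D : Submodule R S, Module.Free R (S ⧸ D) → D = ⊤ := by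
  have hne : {S : Submodule R N | Module.rank R S < ℵ₀ ∧ ¬ Module.Free R S}.Nonempty := by
    by_contra hcon
    rw [Set.not_nonempty_iff_eq_empty] at hcon
    refine h (free_of_countable_of_forall_finite_rank fun S hS => ?_)
    by_contra hS'
    exact Set.eq_empty_iff_forall_notMem.1 hcon S ⟨hS, hS'⟩
  -- A non-free submodule of least finite rank works: if `S ⧸ D` is free and nonzero, then `D` has
  -- smaller rank and is again not free.
  obtain ⟨S, ⟨hS, hS'⟩, hmin⟩ := WellFounded.has_min
    (InvImage.wf (fun S : Submodule R N => Module.finrank R S) Nat.lt_wfRel.wf) _ hne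
  refine ⟨S, ?_, fun D hD => ?_⟩
  · rintro rfl
    exact hS' inferInstance
  by_contra hDtop
  have hDfree : ¬ Module.Free R D := fun _ => hS' (free_of_free_quotient D)
  let e : D ≃ₗ[R] D.map S.subtype := Submodule.equivMapOfInjective _ S.injective_subtype D
  have hrk := Submodule.rank_quotient_add_rank D
  have hDrank : Module.rank R D < ℵ₀ := (Submodule.rank_le D).trans_lt hS
  have hQrank : Module.rank R (S ⧸ D) < ℵ₀ := (rank_quotient_le D).trans_lt hS
  have hQ0 : Module.rank R (S ⧸ D) ≠ 0 := by
    rw [Ne, rank_zero_iff]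
    intro hsub
    exact hDtop (Submodule.Quotient.subsingleton_iff.1 hsub)
  refine hmin (D.map S.subtype) ⟨?_, fun _ => hDfree (Module.Free.of_equiv e.symm)⟩ ?_
  · rwa [← e.rank_eq]
  · change Module.finrank R (D.map S.subtype) < Module.finrank R S
    rw [← e.finrank_eq]
    obtain ⟨a, ha⟩ := Cardinal.lt_aleph0.1 hQrank
    obtain ⟨b, hb⟩ := Cardinal.lt_aleph0.1 hDrank
    rw [ha, hb] at hrk
    rw [Module.finrank, Module.finrank, ← hrk, hb]
    rw [ha] at hQ0
    have : a ≠ 0 := by exact_mod_cast hQ0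
    rw [← Nat.cast_add, Cardinal.toNat_natCast, Cardinal.toNat_natCast]
    omega

end Pontryagin

/-! ### Vanishing of `Ext` in terms of free presentations -/

section Extensions

theorem exists_comp_eq_of_ker_le {R M N W : Type*} [CommRing R] [AddCommGroup M] [Module R M]
    [AddCommGroup N] [Module R N] [AddCommGroup W] [Module R W] {T : M →ₗ[R] N}
    (hT : Function.Surjective T) {Φ : M →ₗ[R] W} (h : LinearMap.ker T ≤ LinearMap.ker Φ) :
    ∃ g : N →ₗ[R] W, g ∘ₗ T = Φ := by
  refine ⟨(LinearMap.ker T).liftQ Φ h ∘ₗ (T.quotKerEquivOfSurjective hT).symm.toLinearMap, ?_⟩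
  ext x
  have : (T.quotKerEquivOfSurjective hT).symm (T x) = (LinearMap.ker T).mkQ x := by
    rw [LinearEquiv.symm_apply_eq]
    rfl
  simp [this]

variable {R P M N K : Type*} [CommRing R] [IsDomain R] [IsPrincipalIdealRing R]
  [AddCommGroup P] [Module R P] [AddCommGroup M] [Module R M] [AddCommGroup N] [Module R N]
  [AddCommGroup K] [Module R K]

/-- If `Ext (N, K) = 0`, expressed through a free presentation of `N`, then a linear map into `K`
extends from the kernel of any linear map into `N`. -/
theorem exists_extension_of_presentation [Module.Free R P] {π : P →ₗ[R] N}
    (hπ : Function.Surjective π)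
    (hext : ∀ f : LinearMap.ker π →ₗ[R] K, ∃ g : P →ₗ[R] K, ∀ x : LinearMap.ker π, g x = f x)
    (σ : M →ₗ[R] N) (f : LinearMap.ker σ →ₗ[R] K) :
    ∃ g : M →ₗ[R] K, ∀ x : LinearMap.ker σ, g x = f x := by
  -- The preimage `P'` is free and has the same kernel, so it presents the range of `σ`. Restricting
  -- to it is the surjection of `Ext` onto that of a submodule.
  let P' : Submodule R P := (LinearMap.range σ).comap π
  have : Module.Free R P' := free_submodule P'
  have hker : LinearMap.ker π ≤ P' := fun x hx => by
    simp only [P', Submodule.mem_comap, LinearMap.mem_ker.1 hx, zero_mem]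
  let π' : P' →ₗ[R] LinearMap.range σ := LinearMap.codRestrict _ (π ∘ₗ P'.subtype) fun x => x.2
  obtain ⟨v, hv⟩ := Module.projective_lifting_property σ.rangeRestrict π'
    σ.surjective_rangeRestrict
  have hv' : ∀ x : P', σ (v x) = π x := fun x =>
    congrArg (fun z : LinearMap.range σ => (z : N)) (LinearMap.congr_fun hv x)
  let w : LinearMap.ker π →ₗ[R] LinearMap.ker σ :=
    LinearMap.codRestrict _ (v ∘ₗ Submodule.inclusion hker) fun x => by
      rw [LinearMap.mem_ker, LinearMap.comp_apply, hv']
      exact x.2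
  obtain ⟨g, hg⟩ := hext (f ∘ₗ w)
  -- `T` exhibits `M` as the pushout of `P'` and `ker σ` over `ker π`. The maps `g` and `f` agree on
  -- `ker π` and therefore glue.
  let T : (P' × LinearMap.ker σ) →ₗ[R] M := v.coprod (LinearMap.ker σ).subtype
  let Φ : (P' × LinearMap.ker σ) →ₗ[R] K := (g ∘ₗ P'.subtype).coprod f
  have hT : Function.Surjective T := fun m => by
    obtain ⟨x, hx⟩ := hπ (σ m)
    have hxP : x ∈ P' := by
      change π x ∈ LinearMap.range σ
      rw [hx]; exact ⟨m, rfl⟩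
    refine ⟨(⟨x, hxP⟩, ⟨m - v ⟨x, hxP⟩, ?_⟩), by simp [T]⟩
    rw [LinearMap.mem_ker, map_sub, hv', hx, sub_self]
  have hle : LinearMap.ker T ≤ LinearMap.ker Φ := by
    rintro ⟨x, y⟩ hxy
    have h1 : v x + (y : M) = 0 := by simpa [T] using hxy
    have hx : (x : P) ∈ LinearMap.ker π := by
      rw [LinearMap.mem_ker, ← hv', eq_neg_of_add_eq_zero_left h1, map_neg, LinearMap.mem_ker.1 y.2,
        neg_zero]
    have h2 := hg ⟨x, hx⟩
    have h3 : w ⟨x, hx⟩ = -y := Subtype.ext (eq_neg_of_add_eq_zero_left h1)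
    rw [LinearMap.comp_apply, h3, map_neg] at h2
    simp only [Φ, LinearMap.mem_ker, LinearMap.coprod_apply, LinearMap.comp_apply,
      Submodule.subtype_apply]
    rw [h2, neg_add_cancel]
  obtain ⟨G, hG⟩ := exists_comp_eq_of_ker_le hT hle
  refine ⟨G, fun x => ?_⟩
  have := LinearMap.congr_fun hG (0, x)
  simpa [T, Φ] using this

end Extensions

/-! ### Modules with `Hom (N, R) = 0` and `Ext (N, R) = 0` -/

section Divisible

variable {R P N : Type*} [CommRing R] [IsDomain R] [IsPrincipalIdealRing R]
  [AddCommGroup P] [Module R P] [AddCommGroup N] [Module R N]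

/-- If `Hom (N, R) = 0` and `Ext (N, R) = 0`, then `N` is divisible by the irreducible elements. -/
theorem exists_smul_eq_of_irreducible [Module.Free R P] {π : P →ₗ[R] N}
    (hπ : Function.Surjective π)
    (hext : ∀ f : LinearMap.ker π →ₗ[R] R, ∃ g : P →ₗ[R] R, ∀ x : LinearMap.ker π, g x = f x)
    (hdual : ∀ f : N →ₗ[R] R, f = 0) {ϖ : R} (hϖ : Irreducible ϖ) (y : N) :
    ∃ z : N, ϖ • z = y := by
  let I : Ideal R := Ideal.span {ϖ}
  have : I.IsMaximal := PrincipalIdealRing.isMaximal_of_irreducible hϖ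
  let _ : Field (R ⧸ I) := Ideal.Quotient.field I
  suffices h : (Submodule.mkQ (I • ⊤ : Submodule R N)) y = 0 by
    have h' : y ∈ (I • ⊤ : Submodule R N) := (Submodule.Quotient.mk_eq_zero _).1 h
    rw [Submodule.ideal_span_singleton_smul] at h'
    obtain ⟨z, -, hz⟩ := h'
    exact ⟨z, hz⟩
  rw [← Module.forall_dual_apply_eq_zero_iff (R ⧸ I)]
  intro ℓ
  -- The obstruction to lifting `lam` to `R` lies in `Ext (N, R)`. Concretely, a lift `θ` of `lam ∘ₗ
  -- π` is divisible by `ϖ` on the kernel. Extending the quotient to `g` makes `θ - ϖ • g` descend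
  -- to a map `N → R`, which is zero, so `lam` vanishes.
  let lam : N →ₗ[R] R ⧸ I := ℓ.restrictScalars R ∘ₗ Submodule.mkQ (I • ⊤ : Submodule R N)
  obtain ⟨θ, hθ⟩ := Module.projective_lifting_property (Submodule.mkQ I) (lam ∘ₗ π)
    (Submodule.mkQ_surjective I)
  have hθ' : ∀ x, (Submodule.mkQ I) (θ x) = lam (π x) := fun x => LinearMap.congr_fun hθ x
  have hmem : ∀ x : LinearMap.ker π, θ x ∈ Submodule.span R {ϖ} := fun x => by
    have := hθ' x
    rw [LinearMap.mem_ker.1 x.2, map_zero] at this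
    exact (Submodule.Quotient.mk_eq_zero I).1 this
  let e := LinearEquiv.toSpanNonzeroSingleton R R ϖ hϖ.ne_zero
  let f : LinearMap.ker π →ₗ[R] R := e.symm.toLinearMap ∘ₗ
    LinearMap.codRestrict (Submodule.span R {ϖ}) (θ ∘ₗ (LinearMap.ker π).subtype) hmem
  have hf : ∀ x : LinearMap.ker π, f x • ϖ = θ x := fun x => by
    have := e.apply_symm_apply ⟨θ x, hmem x⟩
    exact congrArg (fun z : Submodule.span R {ϖ} => (z : R)) this
  obtain ⟨g, hg⟩ := hext f
  have hle : LinearMap.ker π ≤ LinearMap.ker (θ - ϖ • g) := fun x hx => by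
    have h1 := hf ⟨x, hx⟩
    have h2 := hg ⟨x, hx⟩
    simp only [LinearMap.mem_ker, LinearMap.sub_apply, LinearMap.smul_apply]
    rw [← h1, ← h2]
    simp [mul_comm]
  obtain ⟨t, ht⟩ := exists_comp_eq_of_ker_le hπ hle
  rw [hdual t, LinearMap.zero_comp] at ht
  obtain ⟨x, rfl⟩ := hπ y
  have h1 : θ x = ϖ • g x := by
    have := LinearMap.congr_fun ht x
    exact sub_eq_zero.1 (by simpa using this.symm)
  change lam (π x) = 0
  rw [← hθ', h1]
  refine (Submodule.Quotient.mk_eq_zero I).2 ?_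
  exact Ideal.mul_mem_right _ _ (Ideal.mem_span_singleton_self ϖ)

/-- If `N` contains a copy of `R[1 / ϖ]` and `Ext (N, R) = 0`, then `R` is complete in a sense that
is impossible for countable `R`. -/
theorem not_forall_exists_extension_of_smul_eq [Countable R] [Module.IsTorsionFree R N]
    [Module.Free R P] {π : P →ₗ[R] N} (hπ : Function.Surjective π)
    (hext : ∀ f : LinearMap.ker π →ₗ[R] R, ∃ g : P →ₗ[R] R, ∀ x : LinearMap.ker π, g x = f x)
    {ϖ : R} (hϖ : Irreducible ϖ) (y : ℕ → N) (hy0 : y 0 ≠ 0) (hy : ∀ m, ϖ • y (m + 1) = y m) :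
    False := by
  classical
  have hϖ0 := hϖ.ne_zero
  let F := FractionRing R
  have hyn : ∀ m, y m ≠ 0 := fun m => by
    induction m with
    | zero => exact hy0
    | succ m ih => intro h; rw [← hy, h, smul_zero] at ih; exact ih rfl
  have solve : ∀ h : ℕ → R, ∃ z : ℕ → R, ∀ m, ϖ * z (m + 1) = z m + h m := by
    intro h
    -- The system is solved in the fraction field, starting from `0`. On relations among the `y m`
    -- the resulting map `Φ` has values in `R`; extending it to an `R`-valued `g` solves the system
    -- in `R`.
    let x : ℕ → F := fun m => Nat.rec 0 (fun m a => (a + algebraMap R F (h m)) / algebraMap R F ϖ) m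
    have hx : ∀ m, x m = ϖ • x (m + 1) - algebraMap R F (h m) := fun m => by
      have h0 : algebraMap R F ϖ ≠ 0 := by simpa using hϖ0
      have : x (m + 1) = (x m + algebraMap R F (h m)) / algebraMap R F ϖ := rfl
      rw [this, Algebra.smul_def, mul_div_cancel₀ _ h0, add_sub_cancel_right]
    let σ : (ℕ →₀ R) →ₗ[R] N := Finsupp.linearCombination R y
    let Φ : (ℕ →₀ R) →ₗ[R] F := Finsupp.linearCombination R x
    -- Every `a` can be rewritten as a multiple of the `n`-th generator for large `n`, with an error
    -- of `Φ` in `R`. For a relation that multiple is zero.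
    let Q : (ℕ →₀ R) → ℕ → Prop := fun a n =>
      ∃ s r : R, σ a = s • y n ∧ Φ a = s • x n + algebraMap R F r
    have hQ1 : ∀ a n, Q a n → Q a (n + 1) := by
      rintro a n ⟨s, r, h1, h2⟩
      refine ⟨s * ϖ, r - s * h n, by rw [h1, mul_smul, hy], ?_⟩
      rw [h2, hx n, smul_sub, mul_smul, map_sub, map_mul, Algebra.smul_def s (algebraMap R F (h n))]
      ring
    have hQ2 : ∀ a m n, m ≤ n → Q a m → Q a n := fun a m n hmn hm =>
      Nat.le_induction hm (fun k _ hk => hQ1 a k hk) n hmn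
    have hQ : ∀ a, ∃ n, Q a n := by
      intro a
      induction a using Finsupp.induction_linear with
      | zero => exact ⟨0, 0, 0, by simp, by simp⟩
      | add a b ha hb =>
        obtain ⟨m, hm⟩ := ha
        obtain ⟨n, hn⟩ := hb
        obtain ⟨s, r, h1, h2⟩ := hQ2 a m (max m n) (le_max_left _ _) hm
        obtain ⟨s', r', h1', h2'⟩ := hQ2 b n (max m n) (le_max_right _ _) hn
        exact ⟨max m n, s + s', r + r', by rw [map_add, h1, h1', add_smul],
          by rw [map_add, h2, h2', add_smul, map_add]; abel⟩
      | single m c => exact ⟨m, c, 0, by simp [σ], by simp [Φ]⟩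
    have hmem : ∀ a : LinearMap.ker σ, Φ a ∈ LinearMap.range (Algebra.linearMap R F) := by
      intro a
      obtain ⟨n, s, r, h1, h2⟩ := hQ a
      rw [LinearMap.mem_ker.1 a.2] at h1
      have hs : s = 0 := (smul_eq_zero.1 h1.symm).resolve_right (hyn n)
      exact ⟨r, by rw [h2, hs, zero_smul, zero_add]; rfl⟩
    have hinj : Function.Injective (Algebra.linearMap R F) := IsFractionRing.injective R F
    let f : LinearMap.ker σ →ₗ[R] R := (LinearEquiv.ofInjective _ hinj).symm.toLinearMap ∘ₗ
      LinearMap.codRestrict _ (Φ ∘ₗ (LinearMap.ker σ).subtype) hmem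
    have hf : ∀ a : LinearMap.ker σ, algebraMap R F (f a) = Φ a := fun a => by
      have := (LinearEquiv.ofInjective _ hinj).apply_symm_apply ⟨Φ a, hmem a⟩
      exact congrArg (fun z : LinearMap.range (Algebra.linearMap R F) => (z : F)) this
    obtain ⟨g, hg⟩ := exists_extension_of_presentation hπ hext σ f
    refine ⟨fun m => g (Finsupp.single m 1), fun m => ?_⟩
    let a : ℕ →₀ R := ϖ • Finsupp.single (m + 1) 1 - Finsupp.single m 1
    have ha : a ∈ LinearMap.ker σ := by
      simp [a, σ, hy]
    have h1 := hg ⟨a, ha⟩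
    have h2 := hf ⟨a, ha⟩
    have h3 : Φ a = algebraMap R F (h m) := by
      simp only [a, Φ, map_sub, map_smul, Finsupp.linearCombination_single, one_smul]
      rw [hx m]
      abel
    have h4 : f ⟨a, ha⟩ = h m := hinj (h2.trans h3)
    rw [h4] at h1
    simp only [a, map_sub, map_smul, smul_eq_mul] at h1
    rw [← h1]
    ring
  -- The value `z S 0` determines `S`: equal values at `m` force the right-hand sides to agree
  -- modulo `ϖ`, so `S` and `S'` agree at `m`, and cancelling `ϖ` gives equality at `m + 1`. Thus
  -- the power set of `ℕ` would embed into `R`.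
  choose z hz using fun S : Set ℕ => solve fun m => if m ∈ S then 1 else 0
  obtain ⟨ι, hι⟩ := exists_injective_nat R
  refine Function.cantor_injective (fun S => ι (z S 0)) fun S S' h => ?_
  have h0 : z S 0 = z S' 0 := hι h
  have hdvd : ¬ ϖ ∣ 1 := fun h => hϖ.not_isUnit (isUnit_of_dvd_one h)
  have step : ∀ m, z S m = z S' m → ((m ∈ S ↔ m ∈ S') ∧ z S (m + 1) = z S' (m + 1)) := by
    intro m hm
    have h1 := hz S m
    have h2 := hz S' m
    rw [hm] at h1
    by_cases hS : m ∈ S <;> by_cases hS' : m ∈ S' <;> simp only [hS, hS', if_true, if_false] at h1 h2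
    · exact ⟨by simp [hS, hS'], mul_left_cancel₀ hϖ0 (h1.trans h2.symm)⟩
    · exact absurd ⟨z S (m + 1) - z S' (m + 1), by rw [mul_sub, h1, h2]; ring⟩ hdvd
    · exact absurd ⟨z S' (m + 1) - z S (m + 1), by rw [mul_sub, h1, h2]; ring⟩ hdvd
    · exact ⟨by simp [hS, hS'], mul_left_cancel₀ hϖ0 (h1.trans h2.symm)⟩
  have all : ∀ m, z S m = z S' m := fun m => by
    induction m with
    | zero => exact h0
    | succ m ih => exact (step m ih).2
  exact Set.ext fun m => (step m (all m)).1

/-- Over a countable principal ideal domain, a nonzero torsion-free module `N` does not satisfy both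
`Hom (N, R) = 0` and `Ext (N, R) = 0`. -/
theorem not_forall_exists_extension_of_dual_eq_zero [Countable R] [Module.IsTorsionFree R N]
    [Nontrivial N] [Module.Free R P] {π : P →ₗ[R] N} (hπ : Function.Surjective π)
    (hdual : ∀ f : N →ₗ[R] R, f = 0) :
    ¬ ∀ f : LinearMap.ker π →ₗ[R] R, ∃ g : P →ₗ[R] R, ∀ x : LinearMap.ker π, g x = f x := by
  intro hext
  obtain ⟨y, hy⟩ := exists_ne (0 : N)
  -- A field has no irreducible elements, but there the dual separates points.
  by_cases hR : IsField R
  · let _ : Field R := hR.toField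
    have : ∀ ℓ : Module.Dual R N, ℓ y = 0 := fun ℓ => by rw [hdual ℓ]; rfl
    exact hy ((Module.forall_dual_apply_eq_zero_iff R y).1 this)
  · obtain ⟨a, ha0, ha⟩ := Ring.exists_not_isUnit_of_not_isField hR
    obtain ⟨ϖ, hϖ, -⟩ := WfDvdMonoid.exists_irreducible_factor ha ha0
    choose d hd using exists_smul_eq_of_irreducible hπ hext hdual hϖ
    exact not_forall_exists_extension_of_smul_eq hπ hext hϖ (fun m => d^[m] y) hy fun m => by
      rw [Function.iterate_succ_apply', hd]

end Divisible

/-! ### Nonvanishing of `Ext` for countable non-free modules -/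

section Obstruction

variable {R : Type} [CommRing R] [IsDomain R] [IsPrincipalIdealRing R] [Countable R]
  {P N K : Type u} [AddCommGroup P] [Module R P] [AddCommGroup N] [Module R N]
  [AddCommGroup K] [Module R K]

/-- `Ext (N, K) ≠ 0` for countable torsion-free non-free `N` if `K` has a nonzero free submodule
with `ℵ₁`-free quotient. -/
theorem not_forall_exists_extension_of_not_free [Countable N] [Module.IsTorsionFree R N]
    (hN : ¬ Module.Free R N) (K' : Submodule R K) [Nontrivial K'] [Module.Free R K']
    (hK : IsAlephOneFree R (K ⧸ K')) [Module.Free R P] {π : P →ₗ[R] N}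
    (hπ : Function.Surjective π) :
    ¬ ∀ f : LinearMap.ker π →ₗ[R] K, ∃ g : P →ₗ[R] K, ∀ x : LinearMap.ker π, g x = f x := by
  intro hext
  obtain ⟨S, hS, hD⟩ := exists_submodule_without_free_quotient (R := R) hN
  have hzero : ∀ {H : Type u} [AddCommGroup H] [Module R H] (t : S →ₗ[R] H),
      Module.Free R (LinearMap.range t) → t = 0 := fun t ht =>
    LinearMap.ker_eq_top.1 (hD _ (Module.Free.of_equiv t.quotKerEquivRange.symm))
  have : Nontrivial S := Submodule.nontrivial_iff_ne_bot.2 hS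
  obtain ⟨σ, hσ⟩ : ∃ σ : (S →₀ R) →ₗ[R] S, Function.Surjective σ :=
    ⟨_, Finsupp.linearCombination_id_surjective R S⟩
  refine not_forall_exists_extension_of_dual_eq_zero hσ (fun t => ?_) fun f => ?_
  · exact LinearMap.ker_eq_top.1 (hD _ (Module.Free.of_equiv t.quotKerEquivRange.symm))
  have hker : LinearMap.ker (S.subtype ∘ₗ σ) = LinearMap.ker σ :=
    LinearMap.ker_comp_of_ker_eq_bot _ S.ker_subtype
  let b := Module.Free.chooseBasis R K'
  have hne : Nonempty (Module.Free.ChooseBasisIndex R K') := b.index_nonempty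
  let i := hne.some
  let e : R →ₗ[R] K := K'.subtype ∘ₗ LinearMap.toSpanSingleton R K' (b i)
  -- The test map `f` is placed in `K` along a basis vector of `K'`. Modulo `K'` the extension `g`
  -- descends to a map on `S` with countable, hence free, range; this map is zero. So `g` takes
  -- values in `K'`, and a coordinate recovers an extension of `f`.
  obtain ⟨g, hg⟩ := exists_extension_of_presentation hπ hext (S.subtype ∘ₗ σ)
    (e ∘ₗ f ∘ₗ (LinearEquiv.ofEq _ _ hker).toLinearMap)
  have hg' : ∀ x : LinearMap.ker σ, g x = e (f x) := fun x => hg ⟨x, hker.symm ▸ x.2⟩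
  have hle : LinearMap.ker σ ≤ LinearMap.ker (K'.mkQ ∘ₗ g) := fun x hx => by
    rw [LinearMap.mem_ker, LinearMap.comp_apply, hg' ⟨x, hx⟩]
    exact (Submodule.Quotient.mk_eq_zero K').2 (Subtype.property _)
  obtain ⟨t, ht⟩ := exists_comp_eq_of_ker_le hσ hle
  have ht0 : t = 0 := hzero t (by
    have := hK (Set.range t) (Set.countable_range t)
    rwa [← LinearMap.coe_range, Submodule.span_eq] at this)
  rw [ht0, LinearMap.zero_comp] at ht
  have hmem : ∀ x, g x ∈ K' := fun x =>
    (Submodule.Quotient.mk_eq_zero K').1 (LinearMap.congr_fun ht x).symm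
  refine ⟨b.coord i ∘ₗ LinearMap.codRestrict K' g hmem, fun x => ?_⟩
  have : LinearMap.codRestrict K' g hmem x = f x • b i := Subtype.ext (hg' x)
  rw [LinearMap.comp_apply, this]
  simp

end Obstruction

/-! ### Arithmetic of subrings of `ℚ` -/

section SubringRat

/-- Dividing a Bézout relation between numerator and denominator by the denominator writes the
inverse as `a * q + b`. -/
theorem inv_den_mem (R : Subring ℚ) {q : ℚ} (hq : q ∈ R) : (1 / (q.den : ℚ)) ∈ R := by
  have hcop : IsCoprime q.num (q.den : ℤ) := Int.isCoprime_iff_nat_coprime.2 (by simpa using q.reduced)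
  obtain ⟨a, b, hab⟩ := hcop
  have hden : (q.den : ℚ) ≠ 0 := by exact_mod_cast q.den_nz
  have h1 : (1 / (q.den : ℚ)) = a * q + b := by
    have h2 : (a * q.num + b * q.den : ℚ) = 1 := by exact_mod_cast hab
    have h3 : q * q.den = q.num := Rat.mul_den_eq_num q
    rw [div_eq_iff hden, add_mul, mul_assoc, h3, h2]
  rw [h1]
  exact add_mem (mul_mem (intCast_mem R a) hq) (intCast_mem R b)

/-- Subrings of `ℚ` are principal ideal domains. -/
instance isPrincipalIdealRing_subring_rat (R : Subring ℚ) : IsPrincipalIdealRing R where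
  principal I := by
    obtain ⟨n, hn⟩ := (IsPrincipalIdealRing.principal (I.comap (Int.castRingHom R))).principal
    refine ⟨(n : R), le_antisymm (fun x hx => ?_) ?_⟩
    · have h1 : ((x : ℚ).num : R) = (((x : ℚ).den : ℕ) : R) * x := Subtype.ext (by
        push_cast
        rw [mul_comm]
        exact (Rat.mul_den_eq_num (x : ℚ)).symm)
      have h2 : (x : ℚ).num ∈ I.comap (Int.castRingHom R) := by
        change (((x : ℚ).num : ℤ) : R) ∈ I
        rw [h1]
        exact I.mul_mem_left _ hx
      rw [hn, Submodule.mem_span_singleton] at h2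
      obtain ⟨k, hk⟩ := h2
      rw [Submodule.mem_span_singleton]
      refine ⟨(k : R) * ⟨_, inv_den_mem R x.2⟩, Subtype.ext ?_⟩
      have hden : ((x : ℚ).den : ℚ) ≠ 0 := by exact_mod_cast (x : ℚ).den_nz
      have h3 : (k : ℚ) * n = (x : ℚ).num := by exact_mod_cast hk
      have h4 := Rat.mul_den_eq_num (x : ℚ)
      push_cast [smul_eq_mul]
      field_simp
      rw [h3, ← h4, mul_comm]
    · rw [Submodule.span_singleton_le_iff_mem]
      have : n ∈ I.comap (Int.castRingHom R) := hn ▸ Submodule.mem_span_singleton_self n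
      exact this

end SubringRat

/-! ### Permanence properties of `ℵ₁`-free modules -/

section AlephOneFree

variable {R : Type} [CommRing R] {G H : Type u} [AddCommGroup G] [Module R G]
  [AddCommGroup H] [Module R H]

theorem IsAlephOneFree.of_injective (hH : IsAlephOneFree R H) (f : G →ₗ[R] H)
    (hf : Function.Injective f) : IsAlephOneFree R G := fun s hs => by
  have := hH (f '' s) (hs.image f)
  rw [Submodule.span_image] at this
  exact Module.Free.of_equiv (Submodule.equivMapOfInjective f hf (Submodule.span R s)).symm

theorem IsAlephOneFree.of_subsingleton [Subsingleton G] : IsAlephOneFree R G := fun _ _ =>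
  inferInstance

theorem IsAlephOneFree.free_of_countable (h : IsAlephOneFree R G) (N : Submodule R G)
    [Countable N] : Module.Free R N := by
  have := h N (Set.to_countable _)
  rwa [Submodule.span_eq] at this

theorem IsAlephOneFree.isTorsionFree [IsDomain R] (h : IsAlephOneFree R G) :
    Module.IsTorsionFree R G := by
  rw [Module.isTorsionFree_iff_smul_eq_zero]
  intro r x hx
  have := h {x} (Set.countable_singleton x)
  have h1 : r • (⟨x, Submodule.mem_span_singleton_self x⟩ : Submodule.span R {x}) = 0 :=
    Subtype.ext hx
  exact (smul_eq_zero.1 h1).imp_right fun h => congrArg Subtype.val h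

theorem isAlephOneFree_quotient_quotient {A B : Submodule R G} (hAB : A ≤ B) :
    IsAlephOneFree R ((G ⧸ A) ⧸ B.map A.mkQ) ↔ IsAlephOneFree R (G ⧸ B) :=
  let e := Submodule.quotientQuotientEquivQuotient A B hAB
  ⟨fun h => h.of_injective e.symm.toLinearMap e.symm.injective,
    fun h => h.of_injective e.toLinearMap e.injective⟩

variable [IsDomain R] [IsPrincipalIdealRing R]

/-- A countably generated submodule is an extension of its free image in `G ⧸ N` by a submodule of
the free module `N`. -/
theorem IsAlephOneFree.of_quotient (N : Submodule R G) [Module.Free R N]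
    (h : IsAlephOneFree R (G ⧸ N)) : IsAlephOneFree R G := fun s hs => by
  set T := Submodule.span R s with hT
  let f : T →ₗ[R] G ⧸ N := N.mkQ ∘ₗ T.subtype
  have hk : ∀ x : LinearMap.ker f, ((x : T) : G) ∈ N := fun x =>
    (Submodule.Quotient.mk_eq_zero N).1 x.2
  have h1 : Module.Free R (LinearMap.ker f) := free_of_injective
    (LinearMap.codRestrict N (T.subtype ∘ₗ (LinearMap.ker f).subtype) hk)
    fun x y hxy => Subtype.ext (Subtype.ext (congrArg (fun z : N => (z : G)) hxy))
  have h2 : Module.Free R (LinearMap.range f) := by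
    have := h (N.mkQ '' s) (hs.image _)
    rwa [Submodule.span_image, ← hT, ← T.range_subtype, ← LinearMap.range_comp] at this
  have h3 : Module.Free R (T ⧸ LinearMap.ker f) := Module.Free.of_equiv f.quotKerEquivRange.symm
  exact free_of_free_quotient (LinearMap.ker f)

end AlephOneFree

/-! ### The nucleus -/

section Nucleus

theorem one_div_mem_of_prime_factors (S : Subring ℚ) (n : ℕ) (hn : n ≠ 0)
    (h : ∀ p : ℕ, p.Prime → p ∣ n → (1 / (p : ℚ)) ∈ S) : (1 / (n : ℚ)) ∈ S := by
  induction n using induction_on_primes with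
  | zero => exact absurd rfl hn
  | one => simp
  | prime_mul p a hp ih =>
    have ha : a ≠ 0 := fun h => hn (by simp [h])
    have h1 := h p hp (dvd_mul_right _ _)
    have h2 := ih ha fun q hq hqa => h q hq (hqa.mul_left p)
    have := mul_mem h1 h2
    rwa [one_div_mul_one_div, ← Nat.cast_mul] at this

theorem nucleus_eq_of_isAlephOneFree (R : Subring ℚ) (G : Type u) [AddCommGroup G] [Module R G]
    [Nontrivial G] (hG : IsAlephOneFree R G) : nucleus G = R := by
  apply le_antisymm
  · rw [nucleus, Subring.closure_le]
    rintro _ ⟨p, hp, hdiv, rfl⟩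
    choose d hd using hdiv
    obtain ⟨g, hg⟩ := exists_ne (0 : G)
    -- Iterated division by `p` gives a countably generated `p`-divisible submodule. It is free, and
    -- a coordinate of a basis vector divided by `p` is an inverse of `p` in `R`.
    set T := Submodule.span R (Set.range fun m : ℕ => d^[m] g) with hT
    have hfree : Module.Free R T := hG _ (Set.countable_range _)
    have hTdiv : ∀ x ∈ T, ∃ z ∈ T, (p : R) • z = x := by
      intro x hx
      induction hx using Submodule.span_induction with
      | mem x hx =>
        obtain ⟨m, rfl⟩ := hx
        refine ⟨d^[m + 1] g, Submodule.subset_span ⟨m + 1, rfl⟩, ?_⟩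
        simp only [Nat.cast_smul_eq_nsmul]
        rw [Function.iterate_succ_apply', hd]
      | zero => exact ⟨0, zero_mem _, smul_zero _⟩
      | add x y _ _ hx hy =>
        obtain ⟨a, ha, rfl⟩ := hx
        obtain ⟨b, hb, rfl⟩ := hy
        exact ⟨a + b, add_mem ha hb, smul_add _ _ _⟩
      | smul r x _ hx =>
        obtain ⟨a, ha, rfl⟩ := hx
        exact ⟨r • a, T.smul_mem r ha, smul_comm _ _ _⟩
    have hgT : g ∈ T := Submodule.subset_span ⟨0, rfl⟩
    have : Nontrivial T := ⟨⟨⟨g, hgT⟩, 0, fun h => hg (congrArg Subtype.val h)⟩⟩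
    let b := Module.Free.chooseBasis R T
    obtain ⟨i⟩ := b.index_nonempty
    obtain ⟨z, hz, hzb⟩ := hTdiv (b i) (b i).2
    have h1 : (p : R) • (⟨z, hz⟩ : T) = b i := Subtype.ext hzb
    have h2 : (p : R) * b.coord i ⟨z, hz⟩ = 1 := by
      rw [← smul_eq_mul, ← map_smul, h1]
      simp
    have h3 : (p : ℚ) * ((b.coord i ⟨z, hz⟩ : R) : ℚ) = 1 := by
      have := congrArg (fun r : R => (r : ℚ)) h2
      simpa using this
    have h4 : (1 / (p : ℚ)) = ((b.coord i ⟨z, hz⟩ : R) : ℚ) := by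
      rw [div_eq_iff (by exact_mod_cast hp.ne_zero), mul_comm]
      exact h3.symm
    rw [SetLike.mem_coe, h4]
    exact Subtype.property _
  · intro q hq
    have hinv := inv_den_mem R hq
    have h1 : (1 / (q.den : ℚ)) ∈ nucleus G := by
      refine one_div_mem_of_prime_factors _ _ q.den_nz fun p hp hpd => Subring.subset_closure
        ⟨p, hp, fun g => ?_, rfl⟩
      obtain ⟨k, hk⟩ := hpd
      have hp0 : (p : ℚ) ≠ 0 := by exact_mod_cast hp.ne_zero
      have hk0 : (k : ℚ) ≠ 0 := by
        rintro h
        apply q.den_nz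
        rw [hk, (by exact_mod_cast h : k = 0), mul_zero]
      have hpR : (1 / (p : ℚ)) ∈ R := by
        have h2 : (1 / (p : ℚ)) = k * (1 / (q.den : ℚ)) := by
          rw [hk]; push_cast; field_simp
        rw [h2]
        exact mul_mem (natCast_mem R k) hinv
      refine ⟨(⟨_, hpR⟩ : R) • g, ?_⟩
      rw [← Nat.cast_smul_eq_nsmul R, smul_smul]
      have : ((p : R) * ⟨1 / (p : ℚ), hpR⟩ : R) = 1 := Subtype.ext (by
        push_cast
        field_simp)
      rw [this, one_smul]
    have h2 : q = q.num * (1 / (q.den : ℚ)) := by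
      rw [mul_one_div, Rat.num_div_den]
    rw [h2]
    exact mul_mem (intCast_mem _ _) h1

end Nucleus

/-! ### Countable ordinals and closed unbounded sets -/

section OmegaOne

theorem exists_forall_lt_omegaOne {ι : Type*} [Countable ι] (f : ι → OmegaOne) :
    ∃ β : OmegaOne, ∀ i, f i < β := by
  rcases isEmpty_or_nonempty ι with h | h
  · exact ⟨⟨0, Ordinal.omega_pos 1⟩, fun i => h.elim i⟩
  · obtain ⟨e, he⟩ := exists_surjective_nat ι
    have hlt : ∀ n, Order.succ (f (e n)).1 < ω₁ := fun n =>
      by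
      have h := Cardinal.isSuccLimit_ord (Cardinal.aleph0_le_aleph 1)
      rw [Cardinal.ord_aleph] at h
      exact h.succ_lt (f (e n)).2
    refine ⟨⟨⨆ n, Order.succ (f (e n)).1, Ordinal.iSup_lt_omega_one hlt⟩, fun i => ?_⟩
    obtain ⟨n, rfl⟩ := he i
    change (f (e n)).1 < ⨆ n, Order.succ (f (e n)).1
    exact (Order.lt_succ _).trans_le (Ordinal.le_iSup (fun n => Order.succ (f (e n)).1) n)

instance noMaxOrder_omegaOne : NoMaxOrder OmegaOne where
  exists_gt α := (exists_forall_lt_omegaOne fun _ : Unit => α).imp fun _ h => h ()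

theorem nonempty_omegaOne : Nonempty OmegaOne := ⟨⟨0, Ordinal.omega_pos 1⟩⟩

theorem exists_covBy_omegaOne (α : OmegaOne) : ∃ β, α ⋖ β := by
  obtain ⟨β, hβ, hmin⟩ := WellFounded.has_min (wellFounded_lt (α := OmegaOne)) (Set.Ioi α)
    (exists_gt α)
  exact ⟨β, hβ, fun γ h1 h2 => hmin γ h1 h2⟩

theorem exists_isLUB_omegaOne {s : Set OmegaOne} (hs : BddAbove s) : ∃ a, IsLUB s a := by
  obtain ⟨a, ha, hmin⟩ := WellFounded.has_min (wellFounded_lt (α := OmegaOne)) (upperBounds s) hs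
  exact ⟨a, ha, fun b hb => not_lt.1 (hmin b hb)⟩

theorem countable_Iio_omegaOne (α : OmegaOne) : (Set.Iio α).Countable := by
  have h1 : (Set.Iio α.1).Countable := by
    rw [← Cardinal.le_aleph0_iff_set_countable, Cardinal.mk_Iio_ordinal, Cardinal.lift_le_aleph0,
      ← Cardinal.lt_aleph_one_iff, ← Cardinal.lt_ord, Cardinal.ord_aleph]
    exact α.2
  exact (h1.preimage Subtype.val_injective).mono fun β hβ => hβ

theorem mk_omegaOne : Cardinal.mk OmegaOne = ℵ₁ := by
  rw [OmegaOne, Cardinal.mk_Iio_ordinal, Ordinal.card_omega, Cardinal.lift_aleph, Ordinal.lift_one]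

/-- The limit ordinals closed under a given function form a club. -/
theorem isClub_limit_closed {G : Type*} (A : OmegaOne → Set G) (hmono : Monotone A)
    (hcount : ∀ α, (A α).Countable)
    (hcont : ∀ α, Order.IsSuccLimit α → A α ⊆ ⋃ β ∈ Set.Iio α, A β) (b : G → OmegaOne) :
    IsClub {α | Order.IsSuccLimit α ∧ ∀ g ∈ A α, b g < α} := by
  -- A supremum that is not attained is a limit, and closure under `b` is inherited from cofinal
  -- stages. This serves both for closedness and for the `ω`-step closing-off that gives
  -- unboundedness.
  have key : ∀ (t : Set OmegaOne) (a : OmegaOne), t.Nonempty → IsLUB t a → a ∉ t →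
      (∀ γ ∈ t, ∃ δ ∈ t, ∀ g ∈ A γ, b g ≤ δ) →
      a ∈ {α | Order.IsSuccLimit α ∧ ∀ g ∈ A α, b g < α} := by
    intro t a ht ha hat h
    have hlim := ha.isSuccLimit_of_notMem ht hat
    refine ⟨hlim, fun g hg => ?_⟩
    obtain ⟨β, hβ, hgβ⟩ := Set.mem_iUnion₂.1 (hcont a hlim hg)
    obtain ⟨γ, hγ, hβγ⟩ := (lt_isLUB_iff ha).1 hβ
    obtain ⟨δ, hδ, hle⟩ := h γ hγ
    exact (hle g (hmono hβγ.le hgβ)).trans_lt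
      (lt_of_le_of_ne (ha.1 hδ) fun h => hat (h ▸ hδ))
  refine ⟨fun t ht hne _ a ha => ?_, fun α₀ => ?_⟩
  · by_cases hat : a ∈ t
    · exact ht hat
    · exact key t a hne ha hat fun γ hγ => ⟨γ, hγ, fun g hg => ((ht hγ).2 g hg).le⟩
  · have hstep : ∀ α, ∃ β, α < β ∧ ∀ g ∈ A α, b g ≤ β := fun α => by
      have := (hcount α).to_subtype
      obtain ⟨β, hβ⟩ := exists_forall_lt_omegaOne
        (fun g : Option (A α) => g.elim α fun g => b g)
      exact ⟨β, hβ none, fun g hg => (hβ (some ⟨g, hg⟩)).le⟩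
    choose s hs hs' using hstep
    have hbdd : BddAbove (Set.range fun n : ℕ => s^[n] α₀) := by
      obtain ⟨β, hβ⟩ := exists_forall_lt_omegaOne fun n : ℕ => s^[n] α₀
      exact ⟨β, by rintro _ ⟨n, rfl⟩; exact (hβ n).le⟩
    obtain ⟨a, ha⟩ := exists_isLUB_omegaOne hbdd
    have hsucc : ∀ n, s^[n + 1] α₀ = s (s^[n] α₀) := fun n => Function.iterate_succ_apply' s n α₀
    refine ⟨a, key _ a (Set.range_nonempty _) ha ?_ ?_, ha.1 ⟨0, rfl⟩⟩
    · rintro ⟨n, hn⟩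
      have h1 : s^[n + 1] α₀ ≤ a := ha.1 ⟨n + 1, rfl⟩
      have h2 : s^[n] α₀ < s^[n + 1] α₀ := by rw [hsucc]; exact hs _
      exact absurd h1 (not_le.2 (lt_of_eq_of_lt hn.symm h2))
    · rintro _ ⟨n, rfl⟩
      refine ⟨s^[n + 1] α₀, ⟨n + 1, rfl⟩, fun g hg => ?_⟩
      rw [hsucc]
      exact hs' _ g hg

theorem isClub_Ioi_omegaOne (β : OmegaOne) : IsClub (Set.Ioi β) :=
  ⟨fun _ ht hne _ _ ha => hne.elim fun γ hγ => (ht hγ).trans_le (ha.1 hγ), fun α => by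
    obtain ⟨γ, hγ⟩ := exists_gt (max α β)
    exact ⟨γ, (le_max_right _ _).trans_lt hγ, ((le_max_left _ _).trans_lt hγ).le⟩⟩

end OmegaOne

/-! ### Filtrations, invariance of `Γ`, and freeness from a club -/

section Filtration

variable {R : Type} [CommRing R] {G : Type u} [AddCommGroup G] [Module R G]
  {F F' : OmegaOne → Submodule R G}

theorem IsAlephOneFiltration.mem_iff_of_isSuccLimit (hF : IsAlephOneFiltration R F)
    {α : OmegaOne} (hα : Order.IsSuccLimit α) {x : G} : x ∈ F α ↔ ∃ β < α, x ∈ F β := by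
  rw [hF.continuous α hα]
  have hne : (Set.Iio α).Nonempty := by
    obtain ⟨β, hβ⟩ := not_isMin_iff.1 hα.1
    exact ⟨β, hβ⟩
  have : Nonempty (Set.Iio α) := hne.to_subtype
  rw [iSup_subtype', Submodule.mem_iSup_of_directed]
  · simp
  · exact Monotone.directed_le fun a b h => hF.mono h

theorem IsAlephOneFiltration.isClub_limit_closed (hF : IsAlephOneFiltration R F)
    (b : G → OmegaOne) : IsClub {α | Order.IsSuccLimit α ∧ ∀ g ∈ F α, b g < α} :=
  AlmostFreeSplitters.isClub_limit_closed (fun α => (F α : Set G)) (fun _ _ h => hF.mono h)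
    (fun α => Set.countable_coe_iff.1 (hF.countable α))
    (fun _ hα _ hg => Set.mem_iUnion₂.2 (by
      simpa using (hF.mem_iff_of_isSuccLimit hα).1 hg)) b

/-- Any two `ℵ₁`-filtrations yield the same `Γ`-invariant. -/
theorem gammaOf_eq (hF : IsAlephOneFiltration R F) (hF' : IsAlephOneFiltration R F') :
    gammaOf R F = gammaOf R F' := by
  choose b hb using hF.exhaustive
  choose b' hb' using hF'.exhaustive
  -- On the club where each filtration is closed under the index function of the other, their terms
  -- coincide.
  refine Quotient.sound (not_isStationary_iff.2 ⟨_, (hF.isClub_limit_closed b').inter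
    cof_omegaOne_ne (hF'.isClub_limit_closed b), Set.disjoint_left.2 fun α hα hC => ?_⟩)
  have : F α = F' α := le_antisymm
    (fun g hg => hF'.mono (hC.1.2 g hg).le (hb' g)) (fun g hg => hF.mono (hC.2.2 g hg).le (hb g))
  simp only [Set.mem_symmDiff, Set.mem_ofPred_eq] at hα
  rw [this] at hα
  tauto

theorem gammaInvariant_eq (hF : IsAlephOneFiltration R F) :
    gammaOf R F = gammaInvariant R G := by
  have h : ∃ F : OmegaOne → Submodule R G, IsAlephOneFiltration R F := ⟨F, hF⟩
  rw [gammaInvariant, dif_pos h]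
  exact gammaOf_eq hF h.choose_spec

variable [IsDomain R] [IsPrincipalIdealRing R]

/-- A module with an `ℵ₁`-filtration `F` is free if `G / F α` is `ℵ₁`-free on a club. -/
theorem IsAlephOneFiltration.free_of_isClub (hF : IsAlephOneFiltration R F) {C : Set OmegaOne}
    (hC : IsClub C) (h : ∀ α ∈ C, IsAlephOneFree R (G ⧸ F α)) : Module.Free R G := by
  have : Nonempty OmegaOne := nonempty_omegaOne
  have hG : IsAlephOneFree R G := by
    obtain ⟨α, hα⟩ := hC.nonempty
    have := hF.free α
    exact (h α hα).of_quotient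
  have hbelow : ∀ i : C, IsAlephOneFree R (G ⧸ ⨆ j ∈ Set.Iio i, F j.1) := by
    intro i
    rcases (Set.Iio i).eq_empty_or_nonempty with he | hne
    · have : ⨆ j ∈ Set.Iio i, F j.1 = ⊥ := by simp [he]
      rw [this]
      exact hG.of_injective (Submodule.quotEquivOfEqBot ⊥ rfl).toLinearMap
        (Submodule.quotEquivOfEqBot ⊥ rfl).injective
    · obtain ⟨a, ha⟩ := exists_isLUB_omegaOne (s := Subtype.val '' Set.Iio i)
        ⟨i.1, by rintro _ ⟨j, hj, rfl⟩; exact le_of_lt hj⟩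
      -- Closedness of `C` is what puts the union of the earlier terms among the `F a` with `a ∈ C`,
      -- so that its quotient is `ℵ₁`-free.
      have haC : a ∈ C := hC.isLUB_mem (by rintro _ ⟨j, -, rfl⟩; exact j.2) (hne.image _) ha
      have : ⨆ j ∈ Set.Iio i, F j.1 = F a := by
        refine le_antisymm (iSup₂_le fun j hj => hF.mono (ha.1 ⟨j, hj, rfl⟩)) ?_
        have hle : ∀ j ∈ Set.Iio i, F j.1 ≤ ⨆ j ∈ Set.Iio i, F j.1 := fun j hj =>
          le_iSup₂ (f := fun (j : C) (_ : j ∈ Set.Iio i) => F j.1) j hj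
        by_cases hat : a ∈ Subtype.val '' Set.Iio i
        · obtain ⟨j, hj, rfl⟩ := hat
          exact hle j hj
        · intro x hx
          obtain ⟨β, hβ, hxβ⟩ := (hF.mem_iff_of_isSuccLimit
            (ha.isSuccLimit_of_notMem (hne.image _) hat)).1 hx
          obtain ⟨_, ⟨j, hj, rfl⟩, hβj⟩ := (lt_isLUB_iff ha).1 hβ
          exact hle j hj (hF.mono hβj.le hxβ)
      rw [this]
      exact h a haC
  have hcompl : ∀ i : C, ∃ D ≤ F i.1, Disjoint D (⨆ j ∈ Set.Iio i, F j.1) ∧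
      F i.1 ≤ D ⊔ (⨆ j ∈ Set.Iio i, F j.1) ∧ Module.Free R D := by
    intro i
    let f : F i.1 →ₗ[R] G ⧸ ⨆ j ∈ Set.Iio i, F j.1 := (Submodule.mkQ _) ∘ₗ (F i.1).subtype
    have := hF.countable i.1
    have : Countable (LinearMap.range f) := f.surjective_rangeRestrict.countable
    have hfree := (hbelow i).free_of_countable (LinearMap.range f)
    obtain ⟨D, h1, h2, h3, ⟨e⟩⟩ := exists_complement_of_projective_range f
      (A := ⨆ j ∈ Set.Iio i, F j.1) fun y => Submodule.Quotient.mk_eq_zero _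
    exact ⟨D, h1, h2, h3, Module.Free.of_equiv e⟩
  choose D h1 h2 h3 h4 using hcompl
  refine free_of_chain (B := fun i : C => F i.1) (C := D) ?_ h1 h2 h3 h4
  rw [eq_top_iff]
  intro x _
  obtain ⟨α, hα⟩ := hF.exhaustive x
  obtain ⟨β, hβ, hαβ⟩ := hC.isCofinal α
  exact Submodule.mem_iSup_of_mem ⟨β, hβ⟩ (hF.mono hαβ hα)

end Filtration

/-! ### Splitters and extension of maps -/

section Splitters

variable {R : Type} [CommRing R] {G : Type u} [AddCommGroup G] [Module R G]

/-- If `G` is a splitter, then linear maps into `G` extend from the kernel of any presentation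
of `G`. -/
theorem IsSplitter.exists_extension (hG : IsSplitter R G) {P : Type u} [AddCommGroup P]
    [Module R P] {π : P →ₗ[R] G} (hπ : Function.Surjective π) (ψ : LinearMap.ker π →ₗ[R] G) :
    ∃ φ : P →ₗ[R] G, ∀ x : LinearMap.ker π, φ x = ψ x := by
  -- The quotient by the range of `w` is the pushout of the presentation along `ψ`, an extension of
  -- `G` by `G`. A splitting of it yields the extension of `ψ`.
  let w : LinearMap.ker π →ₗ[R] P × G := (LinearMap.ker π).subtype.prod (-ψ)
  let W := LinearMap.range w
  have hW : ∀ x : LinearMap.ker π, W.mkQ ((x : P), 0) = W.mkQ (0, ψ x) := fun x => by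
    rw [← sub_eq_zero, ← map_sub]
    exact (Submodule.Quotient.mk_eq_zero W).2 ⟨x, by simp [w]⟩
  let β : G →ₗ[R] (P × G) ⧸ W := W.mkQ ∘ₗ LinearMap.inr R P G
  have hle : W ≤ LinearMap.ker (π ∘ₗ LinearMap.fst R P G) := by
    rintro _ ⟨x, rfl⟩
    exact x.2
  let α : ((P × G) ⧸ W) →ₗ[R] G := W.liftQ (π ∘ₗ LinearMap.fst R P G) hle
  have hα : ∀ y, α (W.mkQ y) = π y.1 := fun y => rfl
  have hβinj : Function.Injective β := by
    rw [injective_iff_map_eq_zero]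
    intro g hg
    obtain ⟨x, hx⟩ := (Submodule.Quotient.mk_eq_zero W).1 hg
    have h1 : (x : P) = 0 := congrArg Prod.fst hx
    have h2 : -ψ x = g := congrArg Prod.snd hx
    rw [← h2, show x = 0 from Subtype.ext h1, map_zero, neg_zero]
  have hexact : Function.Exact β α := by
    intro y
    obtain ⟨⟨p, g⟩, rfl⟩ := W.mkQ_surjective y
    rw [hα]
    constructor
    · intro hp
      refine ⟨ψ ⟨p, hp⟩ + g, ?_⟩
      have h1 : W.mkQ (p, g) = W.mkQ (p, 0) + W.mkQ (0, g) := by rw [← map_add]; simp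
      have h2 : β (ψ ⟨p, hp⟩ + g) = W.mkQ (0, ψ ⟨p, hp⟩) + W.mkQ (0, g) := map_add β _ _
      rw [h1, h2, hW ⟨p, hp⟩]
    · rintro ⟨g', hg'⟩
      have : α (β g') = 0 := by
        change π 0 = 0
        exact map_zero π
      rwa [hg', hα] at this
  have hαsurj : Function.Surjective α := fun g => by
    obtain ⟨p, hp⟩ := hπ g
    exact ⟨W.mkQ (p, 0), hp⟩
  obtain ⟨γ, hγ⟩ := hG _ β α hβinj hexact hαsurj
  let θ : P →ₗ[R] (P × G) ⧸ W := W.mkQ ∘ₗ LinearMap.inl R P G - γ ∘ₗ π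
  have hθ : ∀ p, θ p ∈ LinearMap.range β := fun p => by
    refine (hexact _).1 ?_
    have : α (γ (π p)) = π p := LinearMap.congr_fun hγ (π p)
    change α (W.mkQ (p, 0) - γ (π p)) = 0
    rw [map_sub, this, hα, sub_self]
  let e := LinearEquiv.ofInjective β hβinj
  refine ⟨e.symm.toLinearMap ∘ₗ LinearMap.codRestrict _ θ hθ, fun x => ?_⟩
  change e.symm ⟨θ x, _⟩ = ψ x
  rw [LinearEquiv.symm_apply_eq]
  refine Subtype.ext ?_
  change W.mkQ ((x : P), 0) - γ (π x) = W.mkQ (0, ψ x)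
  rw [LinearMap.mem_ker.1 x.2, map_zero, sub_zero, hW]

/-- Free modules are splitters. -/
theorem isSplitter_of_free [Module.Free R G] : IsSplitter R G := fun _ _ _ _ α _ _ hα =>
  Module.projective_lifting_property α LinearMap.id hα

end Splitters

/-! ### The canonical presentation and its relations -/

section CanonicalPresentation

variable (R : Type) [CommRing R] (G : Type u) [AddCommGroup G] [Module R G]

/-- The kernel of the canonical presentation of `G` by the free module on its elements. -/
noncomputable abbrev relations : Submodule R (G →₀ R) := LinearMap.ker (Finsupp.linearCombination R (id : G → G))

/-- The relations among the elements of `A`. -/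
noncomputable def relationsIn (A : Set G) : Submodule R (relations R G) :=
  (Finsupp.supported R R A).comap (relations R G).subtype

variable {R G}

theorem relationsIn_mono {A A' : Set G} (h : A ⊆ A') : relationsIn R G A ≤ relationsIn R G A' :=
  Submodule.comap_mono (Finsupp.supported_mono h)

variable [IsDomain R] [IsPrincipalIdealRing R]

/-- A relation whose coordinates outside the earlier sets all vanish has finite support, so it
already lies in one earlier stage. Hence the quotient embeds into the free module on the elements
outside and is itself free. -/
theorem exists_complement_relationsIn {ι : Type*} [LinearOrder ι] (A : ι → Set G)
    (hA : Monotone A) (i : ι) :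
    ∃ D ≤ relationsIn R G (A i), Disjoint D (⨆ j ∈ Set.Iio i, relationsIn R G (A j)) ∧
      relationsIn R G (A i) ≤ D ⊔ ⨆ j ∈ Set.Iio i, relationsIn R G (A j) := by
  classical
  let U : Set G := ⋃ j ∈ Set.Iio i, A j
  let f : relationsIn R G (A i) →ₗ[R] ((Uᶜ : Set G) →₀ R) :=
    Finsupp.lsubtypeDomain (Uᶜ : Set G) ∘ₗ (relations R G).subtype ∘ₗ
      (relationsIn R G (A i)).subtype
  have hf : ∀ x, f x = 0 ↔ (x : relations R G) ∈ ⨆ j ∈ Set.Iio i, relationsIn R G (A j) := by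
    intro x
    constructor
    · intro hx
      have hsupp : ∀ g ∈ (x : relations R G).1.support, g ∈ U := fun g hg => by
        by_contra hgU
        exact Finsupp.mem_support_iff.1 hg (DFunLike.congr_fun hx (⟨g, hgU⟩ : (Uᶜ : Set G)))
      rcases (Set.Iio i).eq_empty_or_nonempty with he | hne
      · have h0 : (x : relations R G) = 0 := by
          refine Subtype.ext (Finsupp.support_eq_empty.1 (Finset.eq_empty_of_forall_notMem
            fun g hg => ?_))
          have := hsupp g hg
          simp [U, he] at this
        rw [h0]
        exact zero_mem _
      · have : Nonempty (Set.Iio i) := hne.to_subtype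
        have h1 : ∀ g : (x : relations R G).1.support, ∃ j : Set.Iio i, (g : G) ∈ A j := fun g => by
          obtain ⟨j, hj, hg⟩ := Set.mem_iUnion₂.1 (hsupp g g.2)
          exact ⟨⟨j, hj⟩, hg⟩
        choose b hb using h1
        obtain ⟨k, hk⟩ := Finset.exists_le (Finset.univ.image b)
        refine Submodule.mem_iSup_of_mem k.1 (Submodule.mem_iSup_of_mem k.2 ?_)
        refine (Finsupp.mem_supported R _).2 fun g hg => ?_
        exact hA (hk _ (Finset.mem_image_of_mem b (Finset.mem_univ ⟨g, hg⟩))) (hb ⟨g, hg⟩)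
    · intro hx
      have hle : ⨆ j ∈ Set.Iio i, relationsIn R G (A j) ≤ relationsIn R G U :=
        iSup₂_le fun j hj => relationsIn_mono (Set.subset_biUnion_of_mem (u := fun j => A j) hj)
      have h1 := (Finsupp.mem_supported' R _).1 (hle hx)
      ext g
      exact h1 g g.2
  have : Module.Free R (LinearMap.range f) := free_submodule _
  obtain ⟨D, h1, h2, h3, -⟩ := exists_complement_of_projective_range
    (R := R) (M := relations R G) (A := ⨆ j ∈ Set.Iio i, relationsIn R G (A j)) (B := relationsIn R G (A i)) f hf
  exact ⟨D, h1, h2, h3⟩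

/-- Let `D` be a complement of the relations in `A` among those in `A'`. If `A' / A` is countable
and not free, then some linear map on `D` is not the restriction of a linear map `φ` which respects
the submodules `A` and `A'`. -/
theorem exists_linearMap_not_extendable [Countable R] {A A' : Submodule R G} (hAA' : A ≤ A')
    [Countable A'] [Module.IsTorsionFree R (G ⧸ A)] (hN : ¬ Module.Free R (A'.map A.mkQ))
    (K : Submodule R (G ⧸ A')) [Nontrivial K] [Module.Free R K]
    (hK : IsAlephOneFree R ((G ⧸ A') ⧸ K)) {D : Submodule R (relations R G)}
    (hD : D ≤ relationsIn R G A') (hsup : relationsIn R G A' ≤ D ⊔ relationsIn R G A) :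
    ∃ c : D →ₗ[R] G, ∀ φ : (G →₀ R) →ₗ[R] G, (∀ x ∈ Finsupp.supported R R (A : Set G), φ x ∈ A') →
      ¬ ∀ x : D, φ (x : relations R G) = c x := by
  classical
  by_contra! hcon
  let π := Finsupp.linearCombination R (id : G → G)
  let P := Finsupp.supported R R (A' : Set G)
  have hπmem : ∀ (B : Submodule R G), ∀ x ∈ Finsupp.supported R R (B : Set G), π x ∈ B :=
    fun B x hx => by
      rw [Finsupp.supported_eq_span_single] at hx
      induction hx using Submodule.span_induction with
      | mem x hx => obtain ⟨g, hg, rfl⟩ := hx; simpa [π] using hg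
      | zero => simp
      | add x y _ _ hx hy => rw [map_add]; exact add_mem hx hy
      | smul r x _ hx => rw [map_smul]; exact B.smul_mem r hx
  let σ : P →ₗ[R] A'.map A.mkQ := LinearMap.codRestrict _ (A.mkQ ∘ₗ π ∘ₗ P.subtype) fun x =>
    ⟨π x, hπmem A' x x.2, rfl⟩
  have hσ : Function.Surjective σ := by
    rintro ⟨_, a, ha, rfl⟩
    refine ⟨⟨Finsupp.single a 1, Finsupp.single_mem_supported R 1 ha⟩, Subtype.ext ?_⟩
    change A.mkQ (π (Finsupp.single a 1)) = A.mkQ a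
    simp [π]
  have hσker : ∀ x : P, x ∈ LinearMap.ker σ ↔ π x ∈ A := fun x => by
    rw [LinearMap.mem_ker, ← Submodule.Quotient.mk_eq_zero A]
    exact ⟨fun h => congrArg Subtype.val h, fun h => Subtype.ext h⟩
  have : Module.Free R P := free_submodule P
  have : Countable (A'.map A.mkQ) := by
    have := (Set.countable_coe_iff.1 ‹Countable A'›).image A.mkQ
    exact this.to_subtype
  refine not_forall_exists_extension_of_not_free (R := R) (P := P) (N := A'.map A.mkQ)
    (K := G ⧸ A') hN K hK (π := σ) hσ fun f => ?_
  have hAP : ∀ x ∈ Finsupp.supported R R (A : Set G), x ∈ P := fun x hx =>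
    Finsupp.supported_mono hAA' hx
  let inc : Finsupp.supported R R (A : Set G) →ₗ[R] LinearMap.ker σ :=
    LinearMap.codRestrict _ (Submodule.inclusion hAP) fun x =>
      (hσker _).2 (hπmem A x x.2)
  -- `f₁` extends the part of `f` on generators from `A` by zero on the other generators. Since `f₁`
  -- is defined on all of `P`, it suffices to extend `f - f₁`, which vanishes on the generators from
  -- `A`.
  let f₁ : P →ₗ[R] G ⧸ A' := f ∘ₗ inc ∘ₗ Finsupp.restrictDom R R (A : Set G) ∘ₗ P.subtype
  let f₂ : LinearMap.ker σ →ₗ[R] G ⧸ A' := f - f₁ ∘ₗ (LinearMap.ker σ).subtype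
  have hf₂ : ∀ x : Finsupp.supported R R (A : Set G), f₂ (inc x) = 0 := fun x => by
    have : Finsupp.restrictDom R R (A : Set G) (x : G →₀ R) = x :=
      LinearMap.congr_fun (Finsupp.restrictDom_comp_subtype (R := R) (M := R) (A : Set G)) x
    change f (inc x) - f (inc (Finsupp.restrictDom R R (A : Set G) (x : G →₀ R))) = 0
    rw [this, sub_self]
  have hDP : ∀ d : D, ((d : relations R G) : G →₀ R) ∈ P := fun d => hD d.2
  let j : D →ₗ[R] LinearMap.ker σ := LinearMap.codRestrict _
    (LinearMap.codRestrict P ((relations R G).subtype ∘ₗ D.subtype) hDP) fun d => by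
      rw [hσker]
      have : π (d : relations R G) = 0 := (d : relations R G).2
      change π (d : relations R G) ∈ A
      rw [this]
      exact zero_mem _
  have : Module.Free R D := by
    have := free_submodule (relations R G)
    exact free_submodule (M := relations R G) D
  obtain ⟨c, hc⟩ := Module.projective_lifting_property A'.mkQ (f₂ ∘ₗ j) A'.mkQ_surjective
  obtain ⟨φ, hφA, hφ⟩ := hcon c
  refine ⟨A'.mkQ ∘ₗ φ ∘ₗ P.subtype + f₁, fun x => ?_⟩
  suffices h : A'.mkQ (φ (x : P)) = f₂ x by
    change A'.mkQ (φ (x : P)) + f₁ x = f x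
    rw [h]
    exact sub_add_cancel (f x) (f₁ x)
  have hxA : π (x : P) ∈ A := (hσker _).1 x.2
  -- Subtracting the generator of its value turns `x` into a genuine relation. So `x` splits into a
  -- part in `D` and a part supported on `A`, and `φ` maps the latter into `A'`.
  let s : G →₀ R := Finsupp.single (π (x : P)) 1
  have hs : s ∈ Finsupp.supported R R (A : Set G) := Finsupp.single_mem_supported R 1 hxA
  have hq : ((x : P) : G →₀ R) - s ∈ relations R G := by
    rw [LinearMap.mem_ker, map_sub]
    simp [s, π]
  have hq' : (⟨_, hq⟩ : relations R G) ∈ relationsIn R G A' :=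
    Submodule.sub_mem P (x : P).2 (hAP s hs)
  obtain ⟨d, hd, a, ha, hda⟩ := Submodule.mem_sup.1 (hsup hq')
  let a' : Finsupp.supported R R (A : Set G) := ⟨(a : G →₀ R) + s, Submodule.add_mem _ ha hs⟩
  have hx : ((x : P) : G →₀ R) = (d : G →₀ R) + a' := by
    have := congrArg Subtype.val hda
    change (d : G →₀ R) + a = (x : P) - s at this
    change _ = (d : G →₀ R) + (a + s)
    rw [← add_assoc, this, sub_add_cancel]
  have hx' : x = j ⟨d, hd⟩ + inc a' := Subtype.ext (Subtype.ext hx)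
  have h1 : A'.mkQ (φ a') = 0 := (Submodule.Quotient.mk_eq_zero A').2 (hφA _ a'.2)
  have h2 : A'.mkQ (c ⟨d, hd⟩) = f₂ (j ⟨d, hd⟩) := LinearMap.congr_fun hc ⟨d, hd⟩
  rw [hx', map_add, hf₂, add_zero, ← h2, ← hφ ⟨d, hd⟩, ← hx', hx, map_add, map_add, h1, add_zero]

end CanonicalPresentation

/-! ### Modules of type II -/

section TypeII

variable {R : Type} [CommRing R] {G : Type u} [AddCommGroup G] [Module R G] {F : OmegaOne → Submodule R G}

theorem not_isSuccLimit_of_covBy {α β : OmegaOne} (h : α ⋖ β) : ¬ Order.IsSuccLimit β :=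
  fun hβ => hβ.isSuccPrelimit α h

theorem not_isSuccLimit_zero : ¬ Order.IsSuccLimit (⟨0, Ordinal.omega_pos 1⟩ : OmegaOne) :=
  fun h => h.1 fun β _ => show (0 : Ordinal) ≤ β.1 from zero_le

/-- A later successor term `F δ`, large enough to contain an element outside `F β`, supplies the
free submodule `F δ / F β` needed for the nonvanishing of `Ext`. -/
theorem IsAlephOneFiltration.exists_nontrivial_submodule (hF : IsAlephOneFiltration R F)
    (hII : ∀ α, ¬ Order.IsSuccLimit α → IsAlephOneFree R (G ⧸ F α)) {β : OmegaOne}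
    (hβ : ¬ Order.IsSuccLimit β) (htop : F β ≠ ⊤) :
    ∃ K : Submodule R (G ⧸ F β), Nontrivial K ∧ Module.Free R K ∧
      IsAlephOneFree R ((G ⧸ F β) ⧸ K) := by
  obtain ⟨x, hx⟩ : ∃ x, x ∉ F β := by
    by_contra! h
    exact htop (eq_top_iff.2 fun x _ => h x)
  obtain ⟨γ, hγ⟩ := hF.exhaustive x
  obtain ⟨δ, hδ⟩ := exists_covBy_omegaOne γ
  have hβγ : β ≤ γ := by
    by_contra h
    exact hx (hF.mono (not_le.1 h).le hγ)
  have hβδ : F β ≤ F δ := hF.mono (hβγ.trans hδ.le)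
  have hcount : Countable ((F δ).map (F β).mkQ) :=
    ((Set.countable_coe_iff.1 (hF.countable δ)).image (F β).mkQ).to_subtype
  refine ⟨(F δ).map (F β).mkQ, ?_, (hII β hβ).free_of_countable _,
    (isAlephOneFree_quotient_quotient hβδ).2 (hII δ (not_isSuccLimit_of_covBy hδ))⟩
  refine ⟨⟨⟨(F β).mkQ x, x, hF.mono hδ.le hγ, rfl⟩, 0, fun h => hx ?_⟩⟩
  exact (Submodule.Quotient.mk_eq_zero (F β)).1 (congrArg Subtype.val h)

variable [IsDomain R]

theorem IsAlephOneFiltration.isTorsionFree_quotient (hF : IsAlephOneFiltration R F)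
    [Module.IsTorsionFree R G] (α : OmegaOne) : Module.IsTorsionFree R (G ⧸ F α) := by
  rw [isTorsionFree_quotient_iff]
  intro r x hr hx
  obtain ⟨y, hy, hyx⟩ := hF.pure α r x hx
  rwa [← smul_right_injective G hr hyx]

variable [IsPrincipalIdealRing R]

theorem IsAlephOneFiltration.isAlephOneFree (hF : IsAlephOneFiltration R F)
    (hII : ∀ α, ¬ Order.IsSuccLimit α → IsAlephOneFree R (G ⧸ F α)) : IsAlephOneFree R G := by
  have := hF.free ⟨0, Ordinal.omega_pos 1⟩
  exact (hII _ not_isSuccLimit_zero).of_quotient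

theorem not_free_map_mkQ {A A' : Submodule R G} (hAA' : A ≤ A')
    (hA' : IsAlephOneFree R (G ⧸ A')) (hA : ¬ IsAlephOneFree R (G ⧸ A)) :
    ¬ Module.Free R (A'.map A.mkQ) := fun _ =>
  hA (((isAlephOneFree_quotient_quotient hAA').2 hA').of_quotient)

/-- If a splitter `G` has an `ℵ₁`-filtration as in the definition of type II, then `G / F α` is
`ℵ₁`-free outside a thin set. -/
theorem IsAlephOneFiltration.not_isStationary_of_isSplitter [Countable R]
    (hF : IsAlephOneFiltration R F)
    (hII : ∀ α, ¬ Order.IsSuccLimit α → IsAlephOneFree R (G ⧸ F α)) (hG : IsSplitter R G) :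
    ¬ IsStationary {α | ¬ IsAlephOneFree R (G ⧸ F α)} := by
  intro hS
  have htf : Module.IsTorsionFree R G := (hF.isAlephOneFree hII).isTorsionFree
  have hmono : Monotone fun α => (F α : Set G) := fun _ _ h => hF.mono h
  have hA := exists_complement_relationsIn (R := R) (fun α => (F α : Set G)) hmono
  choose D h1 h2 h3 using hA
  -- The obstructing map at `β` is chosen for its unique predecessor `α`; where there is nothing to
  -- obstruct, the zero map is taken.
  have hc : ∀ β, ∃ c : D β →ₗ[R] G, ∀ α, α ⋖ β → ¬ IsAlephOneFree R (G ⧸ F α) → F β ≠ ⊤ →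
      ∀ φ : (G →₀ R) →ₗ[R] G, (∀ x ∈ Finsupp.supported R R (F α : Set G), φ x ∈ F β) →
        ¬ ∀ x : D β, φ (x : relations R G) = c x := by
    intro β
    by_cases h : ∃ α, α ⋖ β ∧ ¬ IsAlephOneFree R (G ⧸ F α) ∧ F β ≠ ⊤
    · obtain ⟨α, hαβ, hα, htop⟩ := h
      have hβ := not_isSuccLimit_of_covBy hαβ
      have hle : F α ≤ F β := hF.mono hαβ.le
      have := hF.countable β
      have := hF.isTorsionFree_quotient α
      obtain ⟨K, hK1, hK2, hK3⟩ := hF.exists_nontrivial_submodule hII hβ htop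
      have hbelow : ⨆ j ∈ Set.Iio β, relationsIn R G (F j : Set G) ≤ relationsIn R G (F α) :=
        iSup₂_le fun j hj => relationsIn_mono (hmono (hαβ.le_of_lt hj))
      obtain ⟨c, hc⟩ := exists_linearMap_not_extendable hle
        (not_free_map_mkQ hle (hII β hβ) hα) K hK3 (h1 β) ((h3 β).trans (sup_le_sup_left hbelow _))
      refine ⟨c, fun α' hα' _ _ => ?_⟩
      rw [hα'.unique_left hαβ]
      exact hc
    · push Not at h
      exact ⟨0, fun α hαβ hα htop => absurd (h α hαβ hα) htop⟩
  choose c hc using hc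
  have hBtop : ⨆ α, relationsIn R G (F α : Set G) = ⊤ := by
    choose b hb using hF.exhaustive
    rw [eq_top_iff]
    intro x _
    obtain ⟨β, hβ⟩ := exists_forall_lt_omegaOne fun g : x.1.support => b g
    refine Submodule.mem_iSup_of_mem β ((Finsupp.mem_supported R _).2 fun g hg => ?_)
    exact hF.mono (hβ ⟨g, hg⟩).le (hb g)
  obtain ⟨ψ, hψ⟩ := exists_linearMap_of_chain (R := R) (M := relations R G) (C := D) hBtop h1 h2 h3 c
  obtain ⟨φ, hφ⟩ := hG.exists_extension (Finsupp.linearCombination_id_surjective R G) ψ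
  choose b hb using hF.exhaustive
  obtain ⟨α, hα, hαC⟩ := hS (hF.isClub_limit_closed fun g => b (φ (Finsupp.single g 1)))
  obtain ⟨β, hαβ⟩ := exists_covBy_omegaOne α
  -- A stationary set is unbounded, so if the filtration were constant from `β` on, some later `γ`
  -- in the set would have zero quotient.
  have htop : F β ≠ ⊤ := by
    intro htop
    obtain ⟨γ, hγ, hαγ⟩ := hS (isClub_Ioi_omegaOne α)
    have : F γ = ⊤ := top_le_iff.1 (htop ▸ hF.mono (hαβ.ge_of_gt hαγ))
    refine hγ ?_
    rw [this]
    exact IsAlephOneFree.of_subsingleton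
  refine hc β α hαβ hα htop φ (fun x hx => ?_) fun x => ?_
  · have hx' : x ∈ (F β).comap φ := by
      rw [Finsupp.supported_eq_span_single] at hx
      refine Submodule.span_le.2 ?_ hx
      rintro _ ⟨g, hg, rfl⟩
      exact hF.mono ((hαC.2 g hg).le.trans hαβ.le) (hb _)
    exact hx'
  · rw [← hψ β x]
    exact hφ x.1

theorem IsTypeII.isSplitter_iff [Countable R] (hG : IsTypeII R G) :
    (IsSplitter R G ↔ Module.Free R G) ∧ (IsSplitter R G ↔ gammaInvariant R G = 0) := by
  obtain ⟨F, hF, hII⟩ := hG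
  have h1 : IsSplitter R G → gammaInvariant R G = 0 := fun h => by
    rw [← gammaInvariant_eq hF, gammaOf, gammaValue_eq_zero_iff]
    exact hF.not_isStationary_of_isSplitter hII h
  have h2 : gammaInvariant R G = 0 → Module.Free R G := fun h => by
    rw [← gammaInvariant_eq hF, gammaOf, gammaValue_eq_zero_iff, not_isStationary_iff] at h
    obtain ⟨C, hC, hdisj⟩ := h
    exact hF.free_of_isClub hC fun α hα => by
      by_contra hcon
      exact Set.disjoint_left.1 hdisj hcon hα
  have h3 : Module.Free R G → IsSplitter R G := fun _ => isSplitter_of_free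
  exact ⟨⟨fun h => h2 (h1 h), h3⟩, ⟨h1, fun h => h3 (h2 h)⟩⟩

end TypeII

/-! ### Strongly `ℵ₁`-free modules -/

section StronglyAlephOneFree

theorem exists_surjective_omegaOne {G : Type u} [Nonempty G] (hG : Cardinal.mk G ≤ ℵ₁) :
    ∃ g : OmegaOne → G, Function.Surjective g := by
  have h : Cardinal.lift.{1} (Cardinal.mk G) ≤ Cardinal.lift.{u} (Cardinal.mk OmegaOne) := by
    rw [mk_omegaOne, Cardinal.lift_aleph, Ordinal.lift_one]
    exact (Cardinal.lift_le.2 hG).trans_eq (by simp)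
  obtain ⟨f⟩ := Cardinal.lift_mk_le'.1 h
  exact ⟨Function.invFun f, Function.invFun_surjective f.injective⟩

variable {R : Type} [CommRing R] [IsDomain R] {G : Type u} [AddCommGroup G] [Module R G]

theorem isPureSubmodule_of_isTorsionFree_quotient {H : Submodule R G}
    (h : Module.IsTorsionFree R (G ⧸ H)) : IsPureSubmodule R H := by
  intro r x hx
  by_cases hr : r = 0
  · exact ⟨0, zero_mem _, by simp [hr]⟩
  · exact ⟨x, (isTorsionFree_quotient_iff H).1 h r x hr hx, rfl⟩

/-- A strongly `ℵ₁`-free module of cardinality at most `ℵ₁` is of type II. -/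
theorem IsStronglyAlephOneFree.isTypeII [Countable R] (hG : IsStronglyAlephOneFree R G)
    (hcard : Cardinal.mk G ≤ ℵ₁) : IsTypeII R G := by
  obtain ⟨hfree, hstrong⟩ := hG
  obtain ⟨g, hg⟩ := exists_surjective_omegaOne hcard
  have hspan : ∀ t : Set G, t.Countable → Countable (Submodule.span R t) := fun t ht => by
    have := ht.to_subtype
    have := (LinearMap.surjective_rangeRestrict
      (Finsupp.linearCombination R (Subtype.val : t → G))).countable
    rwa [Finsupp.range_linearCombination, Subtype.range_coe] at this
  -- Defined for every `s`, with a dummy value when `s` is uncountable, so that the recursion below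
  -- needs no countability proof.
  have hstep : ∀ s : Set G, ∃ N : Submodule R G, s.Countable →
      s ⊆ N ∧ Countable N ∧ IsAlephOneFree R (G ⧸ N) := fun s => by
    by_cases hs : s.Countable
    · obtain ⟨t, ht, hst, hN⟩ := hstrong s hs
      exact ⟨Submodule.span R t, fun _ => ⟨hst, hspan t ht, hN⟩⟩
    · exact ⟨⊥, fun h => absurd h hs⟩
  choose ν hν using hstep
  let H : OmegaOne → Submodule R G := (wellFounded_lt (α := OmegaOne)).fix fun α h =>
    ν (insert (g α) (⋃ β : Set.Iio α, (h β.1 β.2 : Set G)))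
  have hH : ∀ α, H α = ν (insert (g α) (⋃ β : Set.Iio α, (H β : Set G))) := fun α =>
    WellFounded.fix_eq _ _ α
  have hcs : ∀ α, Countable (H α) := by
    intro α
    induction α using WellFoundedLT.induction with
    | ind α ih =>
      have := (countable_Iio_omegaOne α).to_subtype
      rw [hH]
      exact (hν _ ((Set.countable_iUnion fun β : Set.Iio α =>
        Set.countable_coe_iff.1 (ih β.1 β.2)).insert _)).2.1
  have hspec : ∀ α, insert (g α) (⋃ β : Set.Iio α, (H β : Set G)) ⊆ H α ∧
      IsAlephOneFree R (G ⧸ H α) := fun α => by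
    have := (countable_Iio_omegaOne α).to_subtype
    have h := hν (insert (g α) (⋃ β : Set.Iio α, (H β : Set G)))
      ((Set.countable_iUnion fun β : Set.Iio α => Set.countable_coe_iff.1 (hcs β)).insert _)
    rw [← hH] at h
    exact ⟨h.1, h.2.2⟩
  have hHlt : ∀ {β α : OmegaOne}, β < α → H β ≤ H α := fun {β α} h x hx =>
    (hspec α).1 (Set.mem_insert_of_mem _ (Set.mem_iUnion.2 ⟨⟨β, h⟩, hx⟩))
  have hHmono : Monotone H := fun β α h => h.eq_or_lt.elim (fun h => h ▸ le_rfl) hHlt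
  -- `H` need not be continuous. Shifting by one makes `F` continuous, with `F` at the successor of
  -- `β` equal to `H β`, so the `ℵ₁`-free quotients appear exactly where type II asks for them.
  let F : OmegaOne → Submodule R G := fun α => ⨆ β ∈ Set.Iio α, H β
  have hHF : ∀ {β α : OmegaOne}, β < α → H β ≤ F α := fun {β α} h =>
    le_iSup₂ (f := fun β (_ : β ∈ Set.Iio α) => H β) β h
  have hFH : ∀ α, F α ≤ H α := fun α => iSup₂_le fun β hβ => hHlt hβ
  have hFcov : ∀ {β α : OmegaOne}, β ⋖ α → F α = H β := fun {β α} h =>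
    le_antisymm (iSup₂_le fun γ hγ => hHmono (h.le_of_lt hγ)) (hHF h.lt)
  have hFmin : ∀ α : OmegaOne, IsMin α → F α = ⊥ := fun α hα => by
    refine le_bot_iff.1 (iSup₂_le fun β hβ => ?_)
    exact absurd hβ (hα.not_lt (b := β))
  have hII : ∀ α, ¬ Order.IsSuccLimit α → IsAlephOneFree R (G ⧸ F α) := by
    intro α hα
    by_cases hmin : IsMin α
    · rw [hFmin α hmin]
      exact hfree.of_injective (Submodule.quotEquivOfEqBot ⊥ rfl).toLinearMap
        (Submodule.quotEquivOfEqBot ⊥ rfl).injective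
    · have h1 : ¬ Order.IsSuccPrelimit α := fun h => hα ⟨hmin, h⟩
      obtain ⟨β, hβ⟩ := Order.not_isSuccPrelimit_iff.1 h1
      rw [hFcov hβ]
      exact (hspec β).2
  have hcount : ∀ α, Countable (F α) := fun α =>
    ((Set.countable_coe_iff.1 (hcs α)).mono (hFH α)).to_subtype
  have hmono : Monotone F := fun β α h => iSup₂_le fun γ hγ => hHF (lt_of_lt_of_le hγ h)
  have hcont : ∀ α, Order.IsSuccLimit α → F α = ⨆ β ∈ Set.Iio α, F β := fun α hα => by
    refine le_antisymm (iSup₂_le fun β hβ => ?_) (iSup₂_le fun β hβ => hmono (le_of_lt hβ))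
    obtain ⟨γ, hγ⟩ := exists_covBy_omegaOne β
    have hγα : γ < α := lt_of_le_of_ne (hγ.ge_of_gt hβ) fun h =>
      hα.isSuccPrelimit β (h ▸ hγ)
    exact le_iSup₂_of_le (f := fun β (_ : β ∈ Set.Iio α) => F β) γ hγα (hHF hγ.lt)
  refine ⟨F, ⟨fun α hα => hFmin α fun β _ => ?_, hmono, hcont, hcount,
    fun α => have := hcount α; hfree.free_of_countable _, fun α => ?_, fun x => ?_⟩, hII⟩
  · change α.1 ≤ β.1
    rw [hα]
    exact zero_le
  -- At limits the quotient need not be `ℵ₁`-free; purity holds there because `F α` is a directed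
  -- union of pure submodules.
  · by_cases hα : Order.IsSuccLimit α
    · intro r x hx
      have hne : Nonempty (Set.Iio α) := (not_isMin_iff.1 hα.1).elim fun β hβ => ⟨⟨β, hβ⟩⟩
      have hdir : Directed (· ≤ ·) fun β : Set.Iio α => H β :=
        Monotone.directed_le fun a b h => hHmono h
      have hmem : ∀ y, y ∈ F α ↔ ∃ β : Set.Iio α, y ∈ H β := fun y => by
        simp only [F]
        rw [iSup_subtype', Submodule.mem_iSup_of_directed _ hdir]
      obtain ⟨β, hβ⟩ := (hmem _).1 hx
      obtain ⟨y, hy, hyx⟩ := isPureSubmodule_of_isTorsionFree_quotient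
        (hspec β.1).2.isTorsionFree r x hβ
      exact ⟨y, (hmem _).2 ⟨β, hy⟩, hyx⟩
    · exact isPureSubmodule_of_isTorsionFree_quotient (hII α hα).isTorsionFree
  · obtain ⟨α, rfl⟩ := hg x
    obtain ⟨β, hβ⟩ := exists_gt α
    exact ⟨β, hHF hβ ((hspec α).1 (Set.mem_insert _ _))⟩

end StronglyAlephOneFree

end AlmostFreeSplitters

theorem theorem6p1 (R : Subring ℚ) (G : Type*) [AddCommGroup G] [Module R G] [Nontrivial G] :
    (AlmostFreeSplitters.IsTypeII R G →
      AlmostFreeSplitters.nucleus G = R ∧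
      (AlmostFreeSplitters.IsSplitter R G ↔ Module.Free R G) ∧
      (∀ F : AlmostFreeSplitters.OmegaOne → Submodule R G,
        AlmostFreeSplitters.IsAlephOneFiltration R F →
          AlmostFreeSplitters.gammaOf R F = AlmostFreeSplitters.gammaInvariant R G) ∧
      (AlmostFreeSplitters.IsSplitter R G ↔ AlmostFreeSplitters.gammaInvariant R G = 0)) ∧
    (AlmostFreeSplitters.IsStronglyAlephOneFree R G → Cardinal.mk G ≤ ℵ₁ →
      ¬ Module.Free R G → ¬ AlmostFreeSplitters.IsSplitter R G) := by
  refine ⟨fun hG => ?_, fun hG hcard hfree hsplit => hfree ((hG.isTypeII hcard).isSplitter_iff.1.1 hsplit)⟩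
  refine ⟨?_, hG.isSplitter_iff.1, fun F hF => AlmostFreeSplitters.gammaInvariant_eq hF, hG.isSplitter_iff.2⟩
  obtain ⟨F, hF, hII⟩ := hG
  exact AlmostFreeSplitters.nucleus_eq_of_isAlephOneFree R G (hF.isAlephOneFree hII)
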